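/- Let $K\subset\mathbb{C}$ be an imaginary quadratic field of discriminant $d_K$ with ring of integers $\mathcal{O}_K$, other than $\mathbb{Q}(\sqrt{-1})$ and $\mathbb{Q}(\sqrt{-3})$, let $N$ be a positive integer and $\mathfrak{n}=N\mathcal{O}_K$. Let $\mathcal{Q}_N(d_K)$ be the set of primitive positive definite forms $Q=ax^2+bxy+cy^2\in\mathbb{Z}[x,y]$ of discriminant $b^2-4ac=d_K$ with $\gcd(N,a)=1$. For $\sigma=\begin{bmatrix}r&s\\u&v\end{bmatrix}\in\mathrm{SL}_2(\mathbb{Z})$ put $Q^\sigma(x,y)=Q(rx+sy,\,ux+vy)$ and, for $\omega$ in the upper half-plane $\mathbb{H}$, $j(\sigma,\omega)=u\omega+v$. Let $\pm\Gamma_1(N)$ be the group of all $\sigma\in\mathrm{SL}_2(\mathbb{Z})$ with $\sigma\equiv\pm\begin{bmatrix}1&*\\0&1\end{bmatrix}\pmod N$, and let $\mathrm{C}_N(d_K)$ be the set of classes $[Q]$ of $\mathcal{Q}_N(d_K)$ under $Q\sim_N Q^\sigma$ $(\sigma\in\pm\Gamma_1(N))$. Let $\omega_Q$ be the zero of $Q(x,1)$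 in $\mathbb{H}$, and write $[\omega,1]=\mathbb{Z}\omega+\mathbb{Z}$. Let $\mathrm{Cl}(\mathfrak{n})=I_K(\mathfrak{n})/P_{K,1}(\mathfrak{n})$ be the ray class group, where $I_K(\mathfrak{n})$ is the group of fractional ideals of $K$ prime to $\mathfrak{n}$ and $P_{K,1}(\mathfrak{n})$ is its subgroup of principal ideals $\lambda\mathcal{O}_K$ with $\lambda\equiv^*1\pmod{\mathfrak{n}}$, i.e. $\lambda=\alpha/\beta$ with nonzero $\alpha,\beta\in\mathcal{O}_K$ prime to $\mathfrak{n}$ and $\alpha\equiv\beta\pmod{\mathfrak{n}}$. Then for each $Q\in\mathcal{Q}_N(d_K)$ the lattice $[\omega_Q,1]$ is a fractional ideal of $K$ prime to $\mathfrak{n}$, and $$\phi_N:\mathrm{C}_N(d_K)\to\mathrm{Cl}(\mathfrak{n}),\qquad [Q]\mapsto\text{ray class of }[\omega_Q,1]$$ is a well-defined bijection. Consequently $\mathrm{C}_N(d_K)$ is an abelian group for which $\phi_N$ is an isomorphism of groups. Its operation is given by Dirichlet composition as follows. Let $Q_i=a_ix^2+b_ixy+c_iy^2\in\mathcal{Q}_N(d_K)$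 for $i=1,2$. 1. There is $\rho\in\mathrm{SL}_2(\mathbb{Z})$ such that $Q_3=Q_2^{\rho}=a_3x^2+b_3xy+c_3y^2$ satisfies $\gcd(a_1,a_3,(b_1+b_3)/2)=1$. 2. For each such $\rho$ there is $B\in\mathbb{Z}$ with $B\equiv b_1\pmod{2a_1}$, $B\equiv b_3\pmod{2a_3}$ and $B^2\equiv d_K\pmod{4a_1a_3}$. 3. For each such $\rho$ and $B$, the Dirichlet composition $Q_0=a_1a_3x^2+Bxy+\frac{B^2-d_K}{4a_1a_3}y^2$ satisfies $[\omega_{Q_1},1][\omega_{Q_3},1]=[\omega_{Q_0},1]$, and there are $u,v\in\mathbb{Z}$ with $j(\rho,\omega_{Q_3})=u\,\omega_{Q_0}+v$. 4. For such $u,v$ there is $\sigma\in\mathrm{SL}_2(\mathbb{Z})$ whose second row is congruent to $(u,v)$ modulo $N$; and for each such $\sigma$ there is $Q_4\in\mathcal{Q}_N(d_K)$ with $Q_4^{\sigma}=Q_0$ (so $\omega_{Q_4}=\sigma(\omega_{Q_0})$) and $[Q_1]\cdot[Q_2]=[Q_4]$. -/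

import Mathlib

open NumberField
open scoped MatrixGroups nonZeroDivisors

/-- An integral binary quadratic form `a x² + b x y + c y²`. -/
@[ext]
structure BinForm where
  a : ℤ
  b : ℤ
  c : ℤ

namespace BinForm

/-- The value `Q(x, y)`. -/
def eval (Q : BinForm) (x y : ℤ) : ℤ := Q.a * x ^ 2 + Q.b * x * y + Q.c * y ^ 2

/-- The discriminant `b² - 4ac`. -/
def disc (Q : BinForm) : ℤ := Q.b ^ 2 - 4 * Q.a * Q.c

/-- The coefficients have no common divisor. -/
def IsPrimitive (Q : BinForm) : Prop := Int.gcd Q.a (Int.gcd Q.b Q.c) = 1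

/-- The form takes only positive values away from the origin. -/
def IsPosDef (Q : BinForm) : Prop := ∀ x y : ℤ, (x, y) ≠ (0, 0) → 0 < Q.eval x y

/-- The form `Q^σ(x, y) = Q(σ (x, y)ᵗ)`, that is, `Q (r x + s y, u x + v y)` for the
matrix `σ` with rows `(r, s)` and `(u, v)`. -/
def act (Q : BinForm) (σ : SL(2, ℤ)) : BinForm where
  a := Q.a * σ 0 0 ^ 2 + Q.b * σ 0 0 * σ 1 0 + Q.c * σ 1 0 ^ 2
  b := 2 * Q.a * σ 0 0 * σ 0 1 + Q.b * (σ 0 0 * σ 1 1 + σ 0 1 * σ 1 0) + 2 * Q.c * σ 1 0 * σ 1 1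
  c := Q.a * σ 0 1 ^ 2 + Q.b * σ 0 1 * σ 1 1 + Q.c * σ 1 1 ^ 2

theorem eval_act (Q : BinForm) (σ : SL(2, ℤ)) (x y : ℤ) :
    (Q.act σ).eval x y = Q.eval (σ 0 0 * x + σ 0 1 * y) (σ 1 0 * x + σ 1 1 * y) := by
  simp only [act, eval]
  ring

theorem act_one (Q : BinForm) : Q.act 1 = Q := by
  ext <;> simp [act]

theorem act_mul (Q : BinForm) (σ τ : SL(2, ℤ)) : Q.act (σ * τ) = (Q.act σ).act τ := by
  ext <;> simp [act, Matrix.mul_apply, Fin.sum_univ_two] <;> ring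

/-- For a positive definite form `Q`, the zero `ω_Q = (-b + √D) / (2a)` of `Q(x, 1)` in the
complex upper half-plane (see `omega_spec`). -/
noncomputable def omega (Q : BinForm) : ℂ :=
  (-(Q.b : ℂ) + Complex.I * (Real.sqrt (-(Q.disc : ℝ)) : ℂ)) / (2 * (Q.a : ℂ))

/-- `omega Q` is the one zero of `Q(x, 1)` in the upper half-plane. -/
theorem omega_spec (Q : BinForm) (ha : 0 < Q.a) (hD : Q.disc < 0) (z : ℂ) :
    (0 < z.im ∧ (Q.a : ℂ) * z ^ 2 + Q.b * z + Q.c = 0) ↔ z = Q.omega := by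
  have haR : (0 : ℝ) < Q.a := by exact_mod_cast ha
  have haC : (Q.a : ℂ) ≠ 0 := by exact_mod_cast ha.ne'
  have hDR : (0 : ℝ) < -(Q.disc : ℝ) := by
    have : (Q.disc : ℝ) < 0 := by exact_mod_cast hD
    linarith
  have hs : 0 < Real.sqrt (-(Q.disc : ℝ)) := Real.sqrt_pos.mpr hDR
  have hsq : ((Real.sqrt (-(Q.disc : ℝ)) : ℝ) : ℂ) ^ 2 = -((Q.b : ℂ) ^ 2 - 4 * Q.a * Q.c) := by
    rw [← Complex.ofReal_pow, Real.sq_sqrt hDR.le]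
    simp [disc]
  generalize hS : Real.sqrt (-(Q.disc : ℝ)) = s at hs hsq
  have hom : Q.omega = (-(Q.b : ℂ) + Complex.I * (s : ℂ)) / (2 * (Q.a : ℂ)) := by
    rw [omega, hS]
  have key : 2 * (Q.a : ℂ) * Q.omega = -(Q.b : ℂ) + Complex.I * s := by
    rw [hom]; field_simp
  have him : Q.omega.im = s / (2 * Q.a) := by
    have h1 := congrArg Complex.im key
    simp at h1
    field_simp
    linarith
  constructor
  · rintro ⟨hz, h0⟩
    have h1 : (2 * (Q.a : ℂ) * z + Q.b - Complex.I * s) *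
        (2 * (Q.a : ℂ) * z + Q.b + Complex.I * s) = 0 := by
      have hI := Complex.I_sq
      linear_combination 4 * (Q.a : ℂ) * h0 - (s : ℂ) ^ 2 * hI + hsq
    rcases mul_eq_zero.mp h1 with h | h
    · have : 2 * (Q.a : ℂ) * z = 2 * (Q.a : ℂ) * Q.omega := by
        rw [key]; linear_combination h
      exact mul_left_cancel₀ (mul_ne_zero two_ne_zero haC) this
    · exfalso
      have h2 := congrArg Complex.im h
      simp at h2
      have : 0 < (Q.a : ℝ) * z.im := mul_pos haR hz
      linarith
  · rintro rfl
    refine ⟨by rw [him]; positivity, ?_⟩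
    have hI := Complex.I_sq
    have h4 : 4 * (Q.a : ℂ) * ((Q.a : ℂ) * Q.omega ^ 2 + Q.b * Q.omega + Q.c) = 0 := by
      linear_combination (2 * (Q.a : ℂ) * Q.omega + Q.b + Complex.I * s) * key
        + (s : ℂ) ^ 2 * hI - hsq
    exact (mul_eq_zero.mp h4).resolve_left (mul_ne_zero (by norm_num) haC)

/-- `gcd (a₁, a₂, (b₁ + b₂) / 2) = 1`; for forms of the same discriminant `b₁ + b₂` is even. -/
def Composable (Q₁ Q₂ : BinForm) : Prop :=
  Int.gcd Q₁.a (Int.gcd Q₂.a ((Q₁.b + Q₂.b) / 2)) = 1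

/-- `B ≡ b₁ mod 2a₁`, `B ≡ b₂ mod 2a₂` and `B² ≡ D mod 4a₁a₂`, where `D` is the discriminant
of `Q₁`. -/
def IsCompositionCoeff (Q₁ Q₂ : BinForm) (B : ℤ) : Prop :=
  B ≡ Q₁.b [ZMOD 2 * Q₁.a] ∧ B ≡ Q₂.b [ZMOD 2 * Q₂.a] ∧
    B ^ 2 ≡ Q₁.disc [ZMOD 4 * Q₁.a * Q₂.a]

/-- The Dirichlet composition `a₁a₂ x² + B x y + (B² - D)/(4a₁a₂) y²` of two forms of
discriminant `D`. -/
def dirichletComp (Q₁ Q₂ : BinForm) (B : ℤ) : BinForm where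
  a := Q₁.a * Q₂.a
  b := B
  c := (B ^ 2 - Q₁.disc) / (4 * Q₁.a * Q₂.a)

end BinForm

/-- The congruence subgroup `±Γ₁(N)` of `SL₂(ℤ)`. -/
def pmGamma1 (N : ℕ) : Subgroup SL(2, ℤ) where
  carrier := {σ | σ ∈ CongruenceSubgroup.Gamma1 N ∨ -σ ∈ CongruenceSubgroup.Gamma1 N}
  one_mem' := Or.inl (one_mem _)
  mul_mem' := by
    rintro σ τ (hσ | hσ) (hτ | hτ)
    · exact Or.inl (mul_mem hσ hτ)
    · exact Or.inr (by simpa using mul_mem hσ hτ)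
    · exact Or.inr (by simpa using mul_mem hσ hτ)
    · exact Or.inl (by simpa using mul_mem hσ hτ)
  inv_mem' := by
    rintro σ (hσ | hσ)
    · exact Or.inl (inv_mem hσ)
    · exact Or.inr (by simpa using inv_mem hσ)

/-- `𝒬_N(d)`: primitive positive definite forms of discriminant `d` with `gcd(N, a) = 1`. -/
def FormsPrimeTo (N : ℕ) (d : ℤ) : Type :=
  {Q : BinForm // Q.IsPrimitive ∧ Q.IsPosDef ∧ Q.disc = d ∧ Int.gcd N Q.a = 1}

/-- The equivalence relation `∼_N` on `𝒬_N(d)` given by the action of `±Γ₁(N)`. -/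
def formSetoid (N : ℕ) (d : ℤ) : Setoid (FormsPrimeTo N d) where
  r Q Q' := ∃ σ ∈ pmGamma1 N, Q'.1 = Q.1.act σ
  iseqv :=
    { refl := fun Q => ⟨1, one_mem _, (Q.1.act_one).symm⟩
      symm := by
        rintro Q Q' ⟨σ, hσ, h⟩
        exact ⟨σ⁻¹, inv_mem hσ, by rw [h, ← BinForm.act_mul, mul_inv_cancel, BinForm.act_one]⟩
      trans := by
        rintro Q Q' Q'' ⟨σ, hσ, h⟩ ⟨τ, hτ, h'⟩
        exact ⟨σ * τ, mul_mem hσ hτ, by rw [h', h, BinForm.act_mul]⟩ }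

/-- The set of classes `C_N(d) = 𝒬_N(d) / ∼_N`. -/
def FormClass (N : ℕ) (d : ℤ) : Type := Quotient (formSetoid N d)

/-- The class `[Q]` of a form. -/
def FormClass.mk {N : ℕ} {d : ℤ} (Q : FormsPrimeTo N d) : FormClass N d :=
  Quotient.mk (formSetoid N d) Q

/-- The lattice `[ω, 1] = ℤω + ℤ` in `ℂ`. -/
def lattice (ω : ℂ) : Submodule ℤ ℂ := Submodule.span ℤ {ω, 1}

section RayClass

variable (K : Type*) [Field K] [NumberField K]

/-- `I_K(𝔫)`: the fractional ideals prime to `𝔫`, that is, those in whose factorization no prime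
dividing `𝔫` occurs. -/
noncomputable def idealsPrimeTo (𝔫 : Ideal (𝓞 K)) : Subgroup (FractionalIdeal (𝓞 K)⁰ K)ˣ where
  carrier := {I | ∀ v : IsDedekindDomain.HeightOneSpectrum (𝓞 K), v.asIdeal ∣ 𝔫 →
    FractionalIdeal.count K v (I : FractionalIdeal (𝓞 K)⁰ K) = 0}
  one_mem' := fun v _ => by simp [FractionalIdeal.count_one]
  mul_mem' := by
    intro I J hI hJ v hv
    rw [Units.val_mul, FractionalIdeal.count_mul K v I.ne_zero J.ne_zero, hI v hv, hJ v hv,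
      add_zero]
  inv_mem' := by
    intro I hI v hv
    rw [Units.val_inv_eq_inv_val, FractionalIdeal.count_inv, hI v hv, neg_zero]

/-- The group of `λ ∈ Kˣ` with `λ ≡* 1 mod 𝔫`: quotients `λ = α / β` of nonzero algebraic integers
prime to `𝔫` with `α ≡ β mod 𝔫`. -/
def congrOne (𝔫 : Ideal (𝓞 K)) : Subgroup Kˣ where
  carrier := {l | ∃ α β : 𝓞 K, α ≠ 0 ∧ β ≠ 0 ∧ IsCoprime (Ideal.span {α}) 𝔫 ∧
    IsCoprime (Ideal.span {β}) 𝔫 ∧ α - β ∈ 𝔫 ∧ (l : K) = (α : K) / (β : K)}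
  one_mem' := ⟨1, 1, one_ne_zero, one_ne_zero,
    by simpa using (isCoprime_one_left (x := 𝔫)), by simpa using (isCoprime_one_left (x := 𝔫)),
    by simp, by simp⟩
  mul_mem' := by
    rintro l m ⟨α, β, hα, hβ, cα, cβ, h, hl⟩ ⟨α', β', hα', hβ', cα', cβ', h', hm⟩
    refine ⟨α * α', β * β', mul_ne_zero hα hα', mul_ne_zero hβ hβ', ?_, ?_, ?_, ?_⟩
    · rw [← Ideal.span_singleton_mul_span_singleton]; exact cα.mul_left cα'
    · rw [← Ideal.span_singleton_mul_span_singleton]; exact cβ.mul_left cβ'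
    · have : α * α' - β * β' = α' * (α - β) + β * (α' - β') := by ring
      rw [this]
      exact 𝔫.add_mem (𝔫.mul_mem_left _ h) (𝔫.mul_mem_left _ h')
    · rw [Units.val_mul, hl, hm, div_mul_div_comm]
      push_cast
      rfl
  inv_mem' := by
    rintro l ⟨α, β, hα, hβ, cα, cβ, h, hl⟩
    refine ⟨β, α, hβ, hα, cβ, cα, ?_, ?_⟩
    · rw [← neg_sub]; exact 𝔫.neg_mem h
    · rw [Units.val_inv_eq_inv_val, hl, inv_div]

/-- `P_{K,1}(𝔫)`: the principal fractional ideals `λ𝓞_K` with `λ ≡* 1 mod 𝔫`. -/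
noncomputable def rayPrincipal (𝔫 : Ideal (𝓞 K)) : Subgroup (FractionalIdeal (𝓞 K)⁰ K)ˣ :=
  (congrOne K 𝔫).map (toPrincipalIdeal (𝓞 K) K)

/-- The ray class group `Cl(𝔫) = I_K(𝔫) / P_{K,1}(𝔫)`. -/
abbrev RayClassGroup (𝔫 : Ideal (𝓞 K)) : Type _ :=
  idealsPrimeTo K 𝔫 ⧸ (rayPrincipal K 𝔫).subgroupOf (idealsPrimeTo K 𝔫)

end RayClass

/-! ### Coprimality and lifting of rows modulo N. -/

section Arithmetic

/-! Write 𝓞_K = ℤ + ℤθ with θ in the upper half-plane. For a form of discriminant d_K, aω_Q = θ - k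
with k an integer (`exists_theta_eq`). Hence ℤω_Q + ℤ is stable under θ, so it is a fractional
ideal, and it lies between 𝓞_K and a⁻¹𝓞_K, so it is prime to N.

Well-definedness and injectivity rest on [ω_{Q^σ}, 1] = j(σ, ω_{Q^σ}) [ω_Q, 1] (`latticeIdeal_act`)
and its converse: a scalar l relating two such lattices is the automorphy factor of some σ ∈ SL₂(ℤ)
carrying one form to the other (`exists_act_eq_of_latticeIdeal_eq`). Since the leading coefficient
is prime to N, comparing coordinates in the basis 1, θ turns l ≡* 1 into σ ∈ Γ₁(N); the sign in
±Γ₁(N) costs nothing because -σ acts as σ.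

For surjectivity, a class is represented, up to a factor ≡ 1 mod N, by an integral ideal J
containing an integer n ≡ 1 mod N. The coordinates of n in an oriented basis of J lift modulo N to
the second row of a matrix in SL₂(ℤ); the new basis ξ, ν has ν ≡ 1 mod N, and ν⁻¹J = [ω_Q, 1] with
gcd(N, a) = 1 (`rayClass_surjective`).

The group law is transported along this bijection. Dirichlet composition multiplies the lattices of
Q₁ and Q₃ = Q₂^ρ (`latticeIdeal_mul`); replacing Q₃ by Q₂ introduces the factor j(ρ, ω_{Q₃}) =
uω_{Q₀} + v. A norm computation (`eval_dirichletComp`) gives Q₀(v, -u) = a₁a₂, prime to N, so (u, v)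
lifts to a row of some σ, and undoing σ on Q₀ cancels the factor up to an element ≡* 1
(`rayClass_mul_eq`). -/

theorem Int.isCoprime_of_forall_prime {a b : ℤ}
    (h : ∀ p : ℕ, p.Prime → (p : ℤ) ∣ a → (p : ℤ) ∣ b → False) : IsCoprime a b := by
  rw [Int.isCoprime_iff_gcd_eq_one]
  by_contra hg
  obtain ⟨p, hp, hpg⟩ := Nat.exists_prime_and_dvd hg
  have hpg' : (p : ℤ) ∣ (Int.gcd a b : ℤ) := Int.natCast_dvd_natCast.mpr hpg
  exact h p hp (hpg'.trans (Int.gcd_dvd_left ..)) (hpg'.trans (Int.gcd_dvd_right ..))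

/-- There is an integer divisible by exactly those prime divisors of `M ≠ 0` that satisfy `P`. -/
theorem exists_int_prime_dvd_iff {M : ℤ} (hM : M ≠ 0) (P : ℕ → Prop) :
    ∃ t : ℤ, ∀ p : ℕ, p.Prime → ((p : ℤ) ∣ t ↔ (p : ℤ) ∣ M ∧ P p) := by
  classical
  refine ⟨((∏ q ∈ M.natAbs.primeFactors with P q, q : ℕ) : ℤ), fun p hp => ?_⟩
  rw [Int.natCast_dvd_natCast, hp.prime.dvd_finsetProd_iff]
  constructor
  · rintro ⟨q, hq, hpq⟩
    rw [Finset.mem_filter, Nat.mem_primeFactors] at hq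
    obtain rfl := (Nat.prime_dvd_prime_iff_eq hp hq.1.1).mp hpq
    exact ⟨Int.natCast_dvd.mpr hq.1.2.1, hq.2⟩
  · rintro ⟨h1, h2⟩
    refine ⟨p, ?_, dvd_rfl⟩
    rw [Finset.mem_filter, Nat.mem_primeFactors]
    exact ⟨⟨hp, Int.natCast_dvd.mp h1, by simpa using hM⟩, h2⟩

/-- Take t divisible by exactly those primes of M that do not divide a: then each prime of M divides
exactly one of a and bt. -/
theorem exists_isCoprime_add_mul {a b M : ℤ} (hM : M ≠ 0)
    (h : ∀ p : ℕ, p.Prime → (p : ℤ) ∣ a → (p : ℤ) ∣ b → (p : ℤ) ∣ M → False) :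
    ∃ t : ℤ, IsCoprime (a + b * t) M := by
  obtain ⟨t, ht⟩ := exists_int_prime_dvd_iff hM (fun p => ¬ (p : ℤ) ∣ a)
  refine ⟨t, Int.isCoprime_of_forall_prime fun p hp h1 h2 => ?_⟩
  by_cases hpa : (p : ℤ) ∣ a
  · rcases (Nat.prime_iff_prime_int.mp hp).dvd_or_dvd ((dvd_add_right hpa).mp h1) with h3 | h3
    · exact h p hp hpa h3 h2
    · exact ((ht p hp).mp h3).2 hpa
  · exact hpa ((dvd_add_left (((ht p hp).mpr ⟨h2, hpa⟩).mul_left b)).mp h1)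

/-- A pair of integers without a common factor with `N` lifts, modulo `N`, to the second row of a
matrix in `SL(2, ℤ)`. -/
theorem exists_SL2_row_modEq {u v N : ℤ} (hN : N ≠ 0)
    (h : ∀ p : ℕ, p.Prime → (p : ℤ) ∣ u → (p : ℤ) ∣ v → (p : ℤ) ∣ N → False) :
    ∃ σ : SL(2, ℤ), σ 1 0 ≡ u [ZMOD N] ∧ σ 1 1 ≡ v [ZMOD N] := by
  -- The modulus for the coprimality lemma must be nonzero, so v = 0 is replaced by N.
  obtain ⟨v', hv', hv⟩ : ∃ v' : ℤ, v' ≠ 0 ∧ v' ≡ v [ZMOD N] := by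
    by_cases hv : v = 0
    · exact ⟨N, hN, by simp [hv, Int.ModEq]⟩
    · exact ⟨v, hv, rfl⟩
  obtain ⟨t, ht⟩ := exists_isCoprime_add_mul (a := u) (b := N) hv' fun p hp h1 h2 h3 =>
    h p hp h1 ((hv.of_dvd h2).dvd_iff.mp h3) h2
  obtain ⟨σ, h0, h1⟩ := ht.exists_SL2_row 1
  exact ⟨σ, by rw [h0]; simp [Int.ModEq], by rw [h1]; exact hv⟩

end Arithmetic

/-! ### Forms: represented integers, the SL₂(ℤ)-action, composability. -/

namespace BinForm

theorem IsPrimitive.not_prime_dvd {Q : BinForm} (hQ : Q.IsPrimitive) {p : ℕ} (hp : p.Prime)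
    (ha : (p : ℤ) ∣ Q.a) (hb : (p : ℤ) ∣ Q.b) (hc : (p : ℤ) ∣ Q.c) : False := by
  have h : (p : ℤ) ∣ (Int.gcd Q.a (Int.gcd Q.b Q.c) : ℤ) :=
    Int.dvd_coe_gcd ha (Int.dvd_coe_gcd hb hc)
  rw [hQ] at h
  exact hp.one_lt.ne' (by simpa [Int.natCast_dvd] using h)

/-- A primitive form properly represents an integer coprime to any given `M ≠ 0`. -/
theorem IsPrimitive.exists_isCoprime_eval {Q : BinForm} (hQ : Q.IsPrimitive) {M : ℤ}
    (hM : M ≠ 0) : ∃ x y : ℤ, IsCoprime x y ∧ IsCoprime M (Q.eval x y) := by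
  -- For each prime of M, the divisibilities of x and y are chosen so that exactly one term
  -- survives: ax² if p ∤ a, cy² if p ∣ a and p ∤ c, and bxy otherwise.
  obtain ⟨y, hy⟩ := exists_int_prime_dvd_iff hM (fun p => ¬ (p : ℤ) ∣ Q.a)
  obtain ⟨x, hx⟩ := exists_int_prime_dvd_iff hM (fun p => (p : ℤ) ∣ Q.a ∧ ¬ (p : ℤ) ∣ Q.c)
  refine ⟨x, y, Int.isCoprime_of_forall_prime fun p hp h1 h2 => ?_,
    Int.isCoprime_of_forall_prime fun p hp hpM h => ?_⟩
  · exact ((hy p hp).mp h2).2 ((hx p hp).mp h1).2.1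
  · have hp' := Nat.prime_iff_prime_int.mp hp
    have ex : ∀ z : ℤ, (p : ℤ) ∣ z ^ 2 → (p : ℤ) ∣ z := fun z hz => hp'.dvd_of_dvd_pow hz
    unfold eval at h
    by_cases ha : (p : ℤ) ∣ Q.a
    · have hny : ¬ (p : ℤ) ∣ y := fun h' => ((hy p hp).mp h').2 ha
      by_cases hc : (p : ℤ) ∣ Q.c
      · have hnx : ¬ (p : ℤ) ∣ x := fun h' => ((hx p hp).mp h').2.2 hc
        have h1 : (p : ℤ) ∣ Q.b * x * y := by
          rw [dvd_add_left (hc.mul_right _)] at h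
          exact (dvd_add_right (ha.mul_right _)).mp h
        rcases hp'.dvd_or_dvd h1 with h2 | h2
        · rcases hp'.dvd_or_dvd h2 with h3 | h3
          · exact hQ.not_prime_dvd hp ha h3 hc
          · exact hnx h3
        · exact hny h2
      · have hpx : (p : ℤ) ∣ x := (hx p hp).mpr ⟨hpM, ha, hc⟩
        have h1 : (p : ℤ) ∣ Q.c * y ^ 2 :=
          (dvd_add_right (dvd_add (ha.mul_right _) ((hpx.mul_left _).mul_right _))).mp h
        rcases hp'.dvd_or_dvd h1 with h2 | h2
        · exact hc h2
        · exact hny (ex _ h2)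
    · have hpy : (p : ℤ) ∣ y := (hy p hp).mpr ⟨hpM, ha⟩
      have hnx : ¬ (p : ℤ) ∣ x := fun h' => ha ((hx p hp).mp h').2.1
      have h1 : (p : ℤ) ∣ Q.a * x ^ 2 := by
        rw [dvd_add_left ((dvd_pow hpy two_ne_zero).mul_left _)] at h
        exact (dvd_add_left (hpy.mul_left _)).mp h
      rcases hp'.dvd_or_dvd h1 with h2 | h2
      · exact ha h2
      · exact hnx (ex _ h2)

theorem det_eq (σ : SL(2, ℤ)) : σ 0 0 * σ 1 1 - σ 0 1 * σ 1 0 = 1 := by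
  rw [← Matrix.det_fin_two, σ.det_coe]

theorem disc_act (Q : BinForm) (σ : SL(2, ℤ)) : (Q.act σ).disc = Q.disc := by
  simp only [disc, act]
  linear_combination (Q.b ^ 2 - 4 * Q.a * Q.c) *
    (σ 0 0 * σ 1 1 - σ 0 1 * σ 1 0 + 1) * det_eq σ

theorem act_neg (Q : BinForm) (σ : SL(2, ℤ)) : Q.act (-σ) = Q.act σ := by
  ext <;> simp [act]

theorem IsPosDef.a_pos {Q : BinForm} (hQ : Q.IsPosDef) : 0 < Q.a := by
  simpa [eval] using hQ 1 0 (by simp)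

theorem IsPosDef.act {Q : BinForm} (hQ : Q.IsPosDef) (σ : SL(2, ℤ)) : (Q.act σ).IsPosDef := by
  intro x y hxy
  rw [eval_act]
  refine hQ _ _ fun h => hxy ?_
  simp only [Prod.mk.injEq] at h ⊢
  constructor
  · linear_combination σ 1 1 * h.1 - σ 0 1 * h.2 - x * det_eq σ
  · linear_combination σ 0 0 * h.2 - σ 1 0 * h.1 - y * det_eq σ

theorem isPosDef_of_a_pos_of_disc_neg {Q : BinForm} (ha : 0 < Q.a) (hd : Q.disc < 0) :
    Q.IsPosDef := by
  intro x y hxy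
  have key : 4 * Q.a * Q.eval x y = (2 * Q.a * x + Q.b * y) ^ 2 + (-Q.disc) * y ^ 2 := by
    simp only [eval, disc]; ring
  refine pos_of_mul_pos_right (b := Q.eval x y) (a := 4 * Q.a) ?_ (by positivity)
  rw [key]
  by_cases hy : y = 0
  · have hx : x ≠ 0 := by rintro rfl; exact hxy (by rw [hy])
    subst hy
    have : 2 * Q.a * x + Q.b * 0 ≠ 0 := by simp [hx, ha.ne']
    have := sq_pos_of_ne_zero this
    linarith
  · have : 0 < -Q.disc := by linarith
    positivity

theorem act_a (Q : BinForm) (σ : SL(2, ℤ)) : (Q.act σ).a = Q.eval (σ 0 0) (σ 1 0) := by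
  simp only [BinForm.act, eval]

theorem act_inv_a (Q : BinForm) (σ : SL(2, ℤ)) : (Q.act σ⁻¹).a = Q.eval (σ 1 1) (-σ 1 0) := by
  rw [act_a]
  simp [Matrix.SpecialLinearGroup.SL2_inv_expl]

/-- Since Q₂ properly represents an integer prime to a₁, the two leading coefficients can even be
made coprime. -/
theorem exists_composable (Q₁ : BinForm) {Q₂ : BinForm} (h₁ : Q₁.a ≠ 0) (h₂ : Q₂.IsPrimitive) :
    ∃ ρ : SL(2, ℤ), Q₁.Composable (Q₂.act ρ) := by
  obtain ⟨x, y, hxy, h⟩ := h₂.exists_isCoprime_eval h₁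
  obtain ⟨ρ, rfl, rfl⟩ := hxy.exists_SL2_col 0
  refine ⟨ρ, ?_⟩
  rw [← act_a, Int.isCoprime_iff_gcd_eq_one] at h
  have h2 : Int.gcd Q₁.a (Int.gcd (Q₂.act ρ).a ((Q₁.b + (Q₂.act ρ).b) / 2)) ∣
      Int.gcd Q₁.a (Q₂.act ρ).a :=
    Int.gcd_dvd_gcd_of_dvd_right _ (Int.gcd_dvd_left ..)
  rw [h] at h2
  exact Nat.dvd_one.mp h2

theorem Composable.exists_bezout {Q₁ Q₂ : BinForm} (h : Q₁.Composable Q₂) :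
    ∃ x y z : ℤ, x * Q₁.a + y * Q₂.a + z * ((Q₁.b + Q₂.b) / 2) = 1 := by
  have h1 := Int.isCoprime_iff_gcd_eq_one.mpr h
  obtain ⟨x, w, hxw⟩ := h1
  refine ⟨x, w * Int.gcdA Q₂.a ((Q₁.b + Q₂.b) / 2), w * Int.gcdB Q₂.a ((Q₁.b + Q₂.b) / 2), ?_⟩
  rw [Int.gcd_eq_gcd_ab] at hxw
  linear_combination hxw

theorem two_dvd_b_add_b {Q₁ Q₂ : BinForm} (h : Q₁.disc = Q₂.disc) : 2 ∣ Q₁.b + Q₂.b := by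
  have h1 : Even (Q₁.b ^ 2 + Q₂.b ^ 2) := by
    unfold disc at h
    exact ⟨Q₂.b ^ 2 + 2 * Q₁.a * Q₁.c - 2 * Q₂.a * Q₂.c, by linear_combination h⟩
  have : Even (Q₁.b + Q₂.b) := by
    simp only [Int.even_add, Int.even_pow, ne_eq, OfNat.ofNat_ne_zero, not_false_eq_true,
      and_true] at h1 ⊢
    exact h1
  exact this.two_dvd

theorem Composable.exists_isCompositionCoeff {Q₁ Q₂ : BinForm} (h : Q₁.Composable Q₂)
    (hd : Q₁.disc = Q₂.disc) : ∃ B : ℤ, Q₁.IsCompositionCoeff Q₂ B := by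
  obtain ⟨x, y, z, hb⟩ := h.exists_bezout
  obtain ⟨s, hs⟩ := two_dvd_b_add_b hd
  have hs' : (Q₁.b + Q₂.b) / 2 = s := by rw [hs]; simp
  rw [hs'] at hb
  unfold disc at hd
  -- `s b₁ - 2 a₁ c₁` is the integer `(b₁ b₂ + D) / 2`.
  have ht : s * Q₁.b - 2 * Q₁.a * Q₁.c = s * Q₂.b - 2 * Q₂.a * Q₂.c := by
    have : 2 * (s * Q₁.b - 2 * Q₁.a * Q₁.c) = 2 * (s * Q₂.b - 2 * Q₂.a * Q₂.c) := by
      linear_combination hd - (Q₁.b - Q₂.b) * hs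
    linarith
  -- The classical solution: the Bézout combination of a₁b₂, a₂b₁ and (b₁b₂ + D)/2.
  obtain ⟨B, hB⟩ : ∃ B, B = x * Q₁.a * Q₂.b + y * Q₂.a * Q₁.b + z * (s * Q₁.b - 2 * Q₁.a * Q₁.c) :=
    ⟨_, rfl⟩
  have h1 : B - Q₁.b = 2 * Q₁.a * (x * (s - Q₁.b) - z * Q₁.c) := by
    linear_combination hB + Q₁.b * hb + x * Q₁.a * hs
  have h2 : B - Q₂.b = 2 * Q₂.a * (y * (s - Q₂.b) - z * Q₂.c) := by
    linear_combination hB + Q₂.b * hb + y * Q₂.a * hs + z * ht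
  refine ⟨B, (Int.modEq_iff_dvd.mpr ⟨_, h1⟩).symm, (Int.modEq_iff_dvd.mpr ⟨_, h2⟩).symm,
    (Int.modEq_iff_dvd.mpr ⟨(x * (s - Q₁.b) - z * Q₁.c) * (y * (s - Q₂.b) - z * Q₂.c) +
      x * Q₂.c + y * Q₁.c, ?_⟩).symm⟩
  -- Twice this says (b₁ + b₂)B ≡ b₁b₂ + D mod 4a₁a₂; adding (B - b₁)(B - b₂) ≡ 0 gives B² ≡ D.
  have h3 : s * B - (s * Q₁.b - 2 * Q₁.a * Q₁.c) =
      2 * Q₁.a * Q₂.a * (x * Q₂.c + y * Q₁.c) := by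
    linear_combination s * hB + (s * Q₁.b - 2 * Q₁.a * Q₁.c) * hb - x * Q₁.a * ht
  unfold disc
  linear_combination (B - Q₂.b) * h1 + 2 * Q₁.a * (x * (s - Q₁.b) - z * Q₁.c) * h2 + 2 * h3 +
    (B - Q₁.b) * hs

end BinForm

/-! ### The ring of integers of an imaginary quadratic field. -/

/-- A generator `θ` of the ring of integers of an imaginary quadratic field `K` embedded in `ℂ`,
with `ι θ` in the upper half-plane, together with the coefficients of its minimal polynomial. -/
structure QuadGen (K : Type*) [Field K] [NumberField K] (ι : K →+* ℂ) where
  θ : 𝓞 K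
  T : ℤ
  n : ℤ
  θ_sq : θ ^ 2 = (T : 𝓞 K) * θ - (n : 𝓞 K)
  span : ∀ x : 𝓞 K, ∃ s t : ℤ, x = (s : 𝓞 K) + (t : 𝓞 K) * θ
  discr_eq : discr K = T ^ 2 - 4 * n
  im_pos : 0 < (ι (θ : K)).im

section Existence

variable {K : Type*} [Field K] [NumberField K]

theorem natCast_mul_ne_one {p : ℕ} (hp : p.Prime) (z : 𝓞 K) : (p : 𝓞 K) * z ≠ 1 := by
  intro h
  have h1 := congrArg (Algebra.norm ℤ) h
  rw [map_mul, map_one] at h1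
  have h2 : Algebra.norm ℤ ((p : ℕ) : 𝓞 K) = (p : ℤ) ^ Module.finrank ℤ (𝓞 K) := by
    have := Algebra.norm_algebraMap (R := ℤ) (S := 𝓞 K) (p : ℤ)
    simpa using this
  rw [h2] at h1
  have h3 : IsUnit ((p : ℤ) ^ Module.finrank ℤ (𝓞 K)) := IsUnit.of_mul_eq_one _ h1
  rw [isUnit_pow_iff Module.finrank_pos.ne'] at h3
  exact (Nat.prime_iff_prime_int.mp hp).not_isUnit h3

/-- The coordinates of 1 in a ℤ-basis are coprime, as no prime divides 1 in 𝓞_K. They therefore form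
the first row of a unimodular matrix, whose second row gives θ. -/
theorem exists_quadratic_generator [Algebra.IsQuadraticExtension ℚ K] :
    ∃ θ : 𝓞 K, ∀ x : 𝓞 K, ∃ s t : ℤ, x = (s : 𝓞 K) + (t : 𝓞 K) * θ := by
  have hrank : Module.finrank ℤ (𝓞 K) = 2 := by
    rw [RingOfIntegers.rank, Algebra.IsQuadraticExtension.finrank_eq_two]
  let b := Module.finBasisOfFinrankEq ℤ (𝓞 K) hrank
  have hb : ∀ z : 𝓞 K, z = ((b.repr z 0 : ℤ) : 𝓞 K) * b 0 + ((b.repr z 1 : ℤ) : 𝓞 K) * b 1 := by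
    intro z
    conv_lhs => rw [← b.sum_repr z]
    simp [Fin.sum_univ_two]
  have hcop : IsCoprime (b.repr 1 0) (b.repr 1 1) := by
    refine Int.isCoprime_of_forall_prime fun p hp ⟨x, hx⟩ ⟨y, hy⟩ => ?_
    refine natCast_mul_ne_one (K := K) hp ((x : 𝓞 K) * b 0 + (y : 𝓞 K) * b 1) ?_
    conv_rhs => rw [hb 1, hx, hy]
    push_cast
    ring
  obtain ⟨g, h0, h1⟩ := hcop.exists_SL2_row 0
  have h1' := hb 1
  rw [← h0, ← h1] at h1'
  have hdet : ((g 0 0 : ℤ) : 𝓞 K) * (g 1 1 : ℤ) - (g 0 1 : ℤ) * (g 1 0 : ℤ) = 1 := by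
    exact_mod_cast congrArg (Int.cast : ℤ → 𝓞 K) (BinForm.det_eq g)
  refine ⟨((g 1 0 : ℤ) : 𝓞 K) * b 0 + ((g 1 1 : ℤ) : 𝓞 K) * b 1, fun z => ?_⟩
  refine ⟨b.repr z 0 * g 1 1 - b.repr z 1 * g 1 0, b.repr z 1 * g 0 0 - b.repr z 0 * g 0 1, ?_⟩
  conv_lhs => rw [hb z]
  push_cast
  linear_combination (-(((b.repr z 0 : ℤ) : 𝓞 K) * b 0 + ((b.repr z 1 : ℤ) : 𝓞 K) * b 1)) * hdet
    - (((b.repr z 0 : ℤ) : 𝓞 K) * (g 1 1 : ℤ) - ((b.repr z 1 : ℤ) : 𝓞 K) * (g 1 0 : ℤ)) * h1'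

theorem discr_eq_of_generator [Algebra.IsQuadraticExtension ℚ K] {θ : 𝓞 K}
    (hθ : ∀ x : 𝓞 K, ∃ s t : ℤ, x = (s : 𝓞 K) + (t : 𝓞 K) * θ) {T n : ℤ}
    (hsq : θ ^ 2 = (T : 𝓞 K) * θ - (n : 𝓞 K)) : discr K = T ^ 2 - 4 * n := by
  have hrank : Module.finrank ℤ (𝓞 K) = 2 := by
    rw [RingOfIntegers.rank, Algebra.IsQuadraticExtension.finrank_eq_two]
  have hspan : ⊤ ≤ Submodule.span ℤ (Set.range ![(1 : 𝓞 K), θ]) := by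
    intro x _
    obtain ⟨s, t, rfl⟩ := hθ x
    simp only [Matrix.range_cons, Matrix.range_empty, Set.union_empty, Set.singleton_union]
    exact Submodule.mem_span_pair.mpr ⟨s, t, by simp⟩
  let b := basisOfTopLeSpanOfCardEqFinrank ![(1 : 𝓞 K), θ] hspan (by simp [hrank])
  have hb0 : b 0 = 1 := by simp [b]
  have hb1 : b 1 = θ := by simp [b]
  have htr : Algebra.trace ℤ (𝓞 K) θ = T := by
    rw [Algebra.trace_eq_matrix_trace b, Matrix.trace_fin_two, Algebra.leftMulMatrix_eq_repr_mul,
      Algebra.leftMulMatrix_eq_repr_mul, hb0, mul_one, hb1, ← sq, hsq]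
    have e1 : b.repr θ = Finsupp.single 1 1 := by rw [← hb1, b.repr_self]
    have e0 : b.repr 1 = Finsupp.single 0 1 := by rw [← hb0, b.repr_self]
    have : (T : 𝓞 K) * θ - (n : 𝓞 K) = T • θ - n • (1 : 𝓞 K) := by simp
    rw [this, map_sub, map_smul, map_smul, e1, e0]
    simp
  have htr1 : Algebra.trace ℤ (𝓞 K) 1 = 2 := by
    have := Algebra.trace_algebraMap (R := ℤ) (S := 𝓞 K) 1
    rw [map_one, hrank] at this
    simpa using this
  have htr2 : Algebra.trace ℤ (𝓞 K) (θ * θ) = T ^ 2 - 2 * n := by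
    have : θ * θ = T • θ - n • (1 : 𝓞 K) := by rw [← sq, hsq]; simp
    rw [this, map_sub, map_smul, map_smul, htr, htr1]
    simp; ring
  rw [← discr_eq_discr K b, Algebra.discr_def, Matrix.det_fin_two]
  simp only [Algebra.traceMatrix_apply, Algebra.traceForm_apply, hb0, hb1, mul_one, one_mul, htr,
    htr1, htr2]
  ring

theorem discr_neg [Algebra.IsQuadraticExtension ℚ K] [IsTotallyComplex K] : discr K < 0 := by
  have h1 : InfinitePlace.nrComplexPlaces K = 1 := by
    have := IsTotallyComplex.finrank K
    rw [Algebra.IsQuadraticExtension.finrank_eq_two] at this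
    omega
  have h2 := sign_discr K
  rw [h1, pow_one] at h2
  exact Int.sign_eq_neg_one_iff_neg.mp h2

theorem nonempty_quadGen [Algebra.IsQuadraticExtension ℚ K] [IsTotallyComplex K] (ι : K →+* ℂ) :
    Nonempty (QuadGen K ι) := by
  obtain ⟨θ, hθ⟩ := exists_quadratic_generator (K := K)
  obtain ⟨m, T, hsq⟩ := hθ (θ ^ 2)
  have hsq' : θ ^ 2 = (T : 𝓞 K) * θ - ((-m : ℤ) : 𝓞 K) := by rw [hsq]; push_cast; ring
  have hd := discr_eq_of_generator hθ hsq'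
  -- A real root θ would make the discriminant T² - 4n the square (2θ - T)², contradicting its
  -- negativity.
  have him : (ι (θ : K)).im ≠ 0 := by
    intro h0
    have h1 := congrArg (fun x : 𝓞 K => (ι (x : K)).re) hsq'
    simp [sq, h0] at h1
    have h2 : ((discr K : ℤ) : ℝ) = (2 * (ι (θ : K)).re - T) ^ 2 := by
      rw [hd]; push_cast
      linear_combination (-4) * h1
    have h3 : ((discr K : ℤ) : ℝ) < 0 := by exact_mod_cast discr_neg (K := K)
    nlinarith [sq_nonneg (2 * (ι (θ : K)).re - T)]
  rcases lt_or_gt_of_ne him with h | h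
  · refine ⟨⟨-θ, -T, -m, ?_, fun x => ?_, ?_, ?_⟩⟩
    · rw [neg_sq, hsq']; push_cast; ring
    · obtain ⟨s, t, hx⟩ := hθ x
      exact ⟨s, -t, by rw [hx]; push_cast; ring⟩
    · rw [hd]; ring
    · simpa using h
  · exact ⟨⟨θ, T, -m, hsq', hθ, hd, h⟩⟩

end Existence

theorem FractionalIdeal.intCast_mul_mem {K : Type*} [Field K] (I : FractionalIdeal (𝓞 K)⁰ K) (s : ℤ) {x : K} (hx : x ∈ I) :
    (s : K) * x ∈ I := by
  have := (I : Submodule (𝓞 K) K).smul_mem (s : 𝓞 K) hx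
  simpa [Algebra.smul_def] using this

/-! ### The lattice [ω_Q, 1] as a fractional ideal. -/

section Lattices

variable {K : Type*} [Field K] [NumberField K] {ι : K →+* ℂ}

theorem int_combination_injective {w : K} (hw : (ι w).im ≠ 0) {s t s' t' : ℤ}
    (h : (s : K) * w + t = s' * w + t') : s = s' ∧ t = t' := by
  have h1 := congrArg (fun x => (ι x).im) h
  have h2 := congrArg (fun x => (ι x).re) h
  simp only [map_add, map_mul, map_intCast, Complex.add_im, Complex.mul_im, Complex.intCast_re,
    Complex.intCast_im, zero_mul, add_zero, mul_eq_mul_right_iff, hw, or_false, Int.cast_inj] at h1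
  subst h1
  simp only [map_add, map_mul, map_intCast, Complex.add_re, Complex.intCast_re, add_right_inj,
    Int.cast_inj] at h2
  exact ⟨rfl, h2⟩

namespace QuadGen

variable (G : QuadGen K ι)

theorem sq_coe : (G.θ : K) ^ 2 = G.T * (G.θ : K) - G.n := by
  have h := congrArg (fun x : 𝓞 K => (x : K)) G.θ_sq
  simpa using h

theorem eq_of_combination_eq {s t s' t' : ℤ}
    (h : (s : K) + t * (G.θ : K) = s' + t' * (G.θ : K)) : s = s' ∧ t = t' := by
  have := int_combination_injective (ι := ι) (w := (G.θ : K)) (s := t) (t := s) (s' := t')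
    (t' := s') G.im_pos.ne' (by linear_combination h)
  exact this.symm

/-- The coefficient of θ on the right is 1. Coprimality of form coefficients is later reduced to
this. -/
theorem int_dvd_one_of_mul_eq_sub (G : QuadGen K ι) {g k : ℤ} {z : 𝓞 K} (h : (g : 𝓞 K) * z = G.θ - k) : g ∣ 1 := by
  obtain ⟨s, t, rfl⟩ := G.span z
  have h' := congrArg (fun x : 𝓞 K => (x : K)) h
  simp only [map_mul, map_add, map_sub, map_intCast] at h'
  have := G.eq_of_combination_eq (s := g * s) (t := g * t) (s' := -k) (t' := 1)
    (by push_cast; linear_combination h')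
  exact ⟨t, this.2.symm⟩

/-- The square root of the discriminant in the upper half-plane. -/
noncomputable def δ : K := 2 * (G.θ : K) - G.T

theorem δ_sq : G.δ ^ 2 = (discr K : K) := by
  rw [G.discr_eq, δ]
  push_cast
  linear_combination 4 * G.sq_coe

/-- The element of `K` whose image in `ℂ` is `ω_Q`. -/
noncomputable def omega (Q : BinForm) : K := (G.δ - Q.b) / (2 * Q.a)

variable {G} {Q : BinForm}

theorem im_δ_pos : 0 < (ι G.δ).im := by
  have him : (ι G.δ).im = 2 * (ι (G.θ : K)).im := by simp [δ, map_ofNat]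
  rw [him]; linarith [G.im_pos]

theorem discr_lt_zero (G : QuadGen K ι) : discr K < 0 := by
  have h := congrArg ι G.δ_sq
  have h2 := congrArg Complex.im h
  have h3 := congrArg Complex.re h
  rw [map_pow, sq] at h2 h3
  simp only [Complex.mul_im, Complex.mul_re, map_intCast, Complex.intCast_im,
    Complex.intCast_re] at h2 h3
  have hp := im_δ_pos (G := G)
  have hre : (ι G.δ).re = 0 := by
    have : 2 * (ι G.δ).im * (ι G.δ).re = 0 := by linarith
    simpa [hp.ne'] using this
  rw [hre] at h3
  have : ((discr K : ℤ) : ℝ) < 0 := by nlinarith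
  exact_mod_cast this

theorem two_mul_omega (ha : 0 < Q.a) : 2 * (Q.a : K) * G.omega Q = G.δ - Q.b := by
  have : (Q.a : K) ≠ 0 := by exact_mod_cast ha.ne'
  rw [omega]
  field_simp

theorem omega_quadratic (ha : 0 < Q.a) (hd : Q.disc = discr K) :
    (Q.a : K) * G.omega Q ^ 2 + Q.b * G.omega Q + Q.c = 0 := by
  have h0 : (4 * Q.a : K) ≠ 0 := by
    have : (Q.a : K) ≠ 0 := by exact_mod_cast ha.ne'
    simp [this]
  have h1 := two_mul_omega (G := G) ha
  have h2 := G.δ_sq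
  rw [← hd, BinForm.disc] at h2
  push_cast at h2
  refine (mul_eq_zero.mp ?_).resolve_left h0
  linear_combination (2 * (Q.a : K) * G.omega Q + Q.b + G.δ) * h1 + h2

theorem im_omega_pos (ha : 0 < Q.a) : 0 < (ι (G.omega Q)).im := by
  have h1 := congrArg (fun x => (ι x).im) (two_mul_omega (G := G) ha)
  simp [Complex.mul_im, map_ofNat] at h1
  have h2 := im_δ_pos (G := G)
  rw [← h1] at h2
  have : (0 : ℝ) < 2 * Q.a := by exact_mod_cast (by linarith : (0 : ℤ) < 2 * Q.a)
  exact pos_of_mul_pos_right h2 this.le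

theorem map_omega (ha : 0 < Q.a) (hd : Q.disc = discr K) : ι (G.omega Q) = Q.omega := by
  refine (Q.omega_spec ha (hd ▸ discr_lt_zero G) _).mp ⟨im_omega_pos ha, ?_⟩
  have h := congrArg ι (omega_quadratic (G := G) ha hd)
  simpa using h

/-- Here k = (b + T)/2, an integer because b² ≡ d_K ≡ T² mod 4. -/
theorem exists_theta_eq (ha : 0 < Q.a) (hd : Q.disc = discr K) :
    ∃ k : ℤ, (G.θ : K) = Q.a * G.omega Q + k := by
  have h1 : Even (Q.b + G.T) := by
    rw [G.discr_eq, BinForm.disc] at hd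
    have h1 : Even (Q.b ^ 2 + G.T ^ 2) := ⟨G.T ^ 2 - 2 * G.n + 2 * Q.a * Q.c, by
      linear_combination hd⟩
    simpa only [Int.even_add, Int.even_pow, ne_eq, OfNat.ofNat_ne_zero, not_false_eq_true,
      and_true] using h1
  obtain ⟨k, hk⟩ := h1
  refine ⟨k, mul_left_cancel₀ (two_ne_zero (α := K)) ?_⟩
  have h2 := two_mul_omega (G := G) ha
  have hk' : (Q.b : K) + G.T = k + k := by exact_mod_cast hk
  rw [δ] at h2
  linear_combination hk' - h2

/-- Forms of fundamental discriminant are primitive. -/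
theorem isPrimitive (G : QuadGen K ι) (ha : 0 < Q.a) (hd : Q.disc = discr K) :
    Q.IsPrimitive := by
  obtain ⟨k, hk⟩ := exists_theta_eq (G := G) ha hd
  rw [BinForm.IsPrimitive]
  have hg := Int.gcd_dvd_left Q.a (Int.gcd Q.b Q.c)
  have hg' := Int.gcd_dvd_right Q.a (Int.gcd Q.b Q.c)
  have hgb := hg'.trans (Int.gcd_dvd_left Q.b Q.c)
  have hgc := hg'.trans (Int.gcd_dvd_right Q.b Q.c)
  set g : ℕ := Int.gcd Q.a (Int.gcd Q.b Q.c)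
  obtain ⟨a', ha'⟩ := hg
  obtain ⟨b', hb'⟩ := hgb
  obtain ⟨c', hc'⟩ := hgc
  have hg0 : (g : K) ≠ 0 := by
    intro h
    rw [Nat.cast_eq_zero.mp h] at ha'
    simp [ha'] at ha
  have hq := omega_quadratic (G := G) ha hd
  rw [hb', hc', ha'] at hq
  rw [ha'] at hk
  push_cast at hq hk
  have hq' : (a' : K) * G.omega Q ^ 2 + b' * G.omega Q + c' = 0 := by
    refine (mul_eq_zero.mp ?_).resolve_left hg0
    linear_combination hq
  -- Dividing Q by its content g keeps ω_Q as a root, so a'ω_Q is already integral although g·a'ω_Q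
  -- = θ - k.
  have h_int : IsIntegral ℤ ((a' : K) * G.omega Q) := by
    refine ⟨Polynomial.X ^ 2 + Polynomial.C b' * Polynomial.X + Polynomial.C (a' * c'), ?_, ?_⟩
    · monicity!
    · rw [← Polynomial.aeval_def]
      simp
      linear_combination (a' : K) * hq'
  obtain ⟨z, hz⟩ : ∃ z : 𝓞 K, (z : K) = a' * G.omega Q := ⟨⟨_, h_int⟩, rfl⟩
  have h1 : ((g : ℤ) : 𝓞 K) * z = G.θ - k := by
    apply RingOfIntegers.coe_injective
    simp only [map_mul, map_sub, map_intCast]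
    push_cast
    linear_combination (g : K) * hz - hk
  have := G.int_dvd_one_of_mul_eq_sub h1
  exact Nat.dvd_one.mp (by exact_mod_cast this)

variable (G Q) in
/-- The fractional ideal `[ω_Q, 1]`. -/
noncomputable def latticeIdeal : FractionalIdeal (𝓞 K)⁰ K :=
  FractionalIdeal.spanSingleton (𝓞 K)⁰ (G.omega Q) + 1

theorem one_le_latticeIdeal : 1 ≤ G.latticeIdeal Q := by
  rw [latticeIdeal, ← FractionalIdeal.sup_eq_add]
  exact le_sup_right

theorem one_mem_latticeIdeal : (1 : K) ∈ G.latticeIdeal Q :=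
  one_le_latticeIdeal (FractionalIdeal.one_mem_one _)

theorem omega_mem_latticeIdeal : G.omega Q ∈ G.latticeIdeal Q := by
  rw [latticeIdeal, ← FractionalIdeal.sup_eq_add]
  exact (le_sup_left : FractionalIdeal.spanSingleton (𝓞 K)⁰ (G.omega Q) ≤ _)
    (FractionalIdeal.mem_spanSingleton_self _ _)

theorem latticeIdeal_ne_zero : G.latticeIdeal Q ≠ 0 := by
  intro h
  have := one_mem_latticeIdeal (G := G) (Q := Q)
  rw [h] at this
  simp at this

/-- The 𝓞_K-span of ω_Q and 1 is no larger than their ℤ-span: θ = aω_Q + k, and θω_Q is reduced by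
the quadratic equation of ω_Q. -/
theorem mem_latticeIdeal (ha : 0 < Q.a) (hd : Q.disc = discr K) {x : K} :
    x ∈ G.latticeIdeal Q ↔ ∃ s t : ℤ, x = s * G.omega Q + t := by
  obtain ⟨k, hk⟩ := exists_theta_eq (G := G) ha hd
  have hq := omega_quadratic (G := G) ha hd
  constructor
  · intro hx
    rw [latticeIdeal, ← FractionalIdeal.mem_coe, FractionalIdeal.coe_add, Submodule.add_eq_sup,
      Submodule.mem_sup] at hx
    obtain ⟨y, hy, z, hz, rfl⟩ := hx
    rw [FractionalIdeal.mem_coe, FractionalIdeal.mem_spanSingleton] at hy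
    rw [FractionalIdeal.mem_coe, FractionalIdeal.mem_one_iff] at hz
    obtain ⟨r, rfl⟩ := hy
    obtain ⟨r', rfl⟩ := hz
    obtain ⟨s, t, rfl⟩ := G.span r
    obtain ⟨s', t', rfl⟩ := G.span r'
    refine ⟨s + t * (k - Q.b) + t' * Q.a, s' + t' * k - t * Q.c, ?_⟩
    simp only [Algebra.smul_def, map_add, map_mul, map_intCast]
    push_cast
    linear_combination (t : K) * hq + (t * G.omega Q + t' : K) * hk
  · rintro ⟨s, t, rfl⟩
    refine (G.latticeIdeal Q : Submodule (𝓞 K) K).add_mem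
      (FractionalIdeal.intCast_mul_mem _ s omega_mem_latticeIdeal) ?_
    simpa using FractionalIdeal.intCast_mul_mem _ t (one_mem_latticeIdeal (G := G) (Q := Q))

theorem image_latticeIdeal (ha : 0 < Q.a) (hd : Q.disc = discr K) :
    ι '' {x : K | x ∈ G.latticeIdeal Q} = (lattice Q.omega : Set ℂ) := by
  ext z
  simp only [Set.mem_image, Set.mem_ofPred_eq, mem_latticeIdeal ha hd, SetLike.mem_coe, lattice,
    Submodule.mem_span_pair, ← map_omega (G := G) ha hd]
  constructor
  · rintro ⟨_, ⟨s, t, rfl⟩, rfl⟩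
    exact ⟨s, t, by simp⟩
  · rintro ⟨s, t, rfl⟩
    exact ⟨_, ⟨s, t, rfl⟩, by simp⟩

/-- `a [ω_Q, 1]` consists of integers. -/
theorem mul_mem_latticeIdeal (ha : 0 < Q.a) (hd : Q.disc = discr K) {x : K}
    (hx : x ∈ G.latticeIdeal Q) : ∃ z : 𝓞 K, (z : K) = Q.a * x := by
  obtain ⟨k, hk⟩ := exists_theta_eq (G := G) ha hd
  obtain ⟨s, t, rfl⟩ := (mem_latticeIdeal ha hd).mp hx
  refine ⟨s * (G.θ - k) + Q.a * t, ?_⟩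
  simp only [map_add, map_mul, map_sub, map_intCast]
  linear_combination (s : K) * hk

theorem act_a_pos (hQ : Q.IsPosDef) (σ : SL(2, ℤ)) : 0 < (Q.act σ).a := (hQ.act σ).a_pos

/-- This is ω_Q = σ(ω_{Q^σ}) without denominators. Multiplied by 4aa' it becomes an identity in δ
with δ² = D; `e1` settles the coefficient of δ, and with `e2` the constant term. -/
theorem omega_mul_act (hQ : Q.IsPosDef) (hd : Q.disc = discr K) (σ : SL(2, ℤ)) :
    G.omega Q * (σ 1 0 * G.omega (Q.act σ) + σ 1 1) = σ 0 0 * G.omega (Q.act σ) + σ 0 1 := by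
  have ha := hQ.a_pos
  have ha' := act_a_pos hQ σ
  have h1 := two_mul_omega (G := G) ha
  have h1' := two_mul_omega (G := G) ha'
  have h2 := G.δ_sq
  have hdet : ((σ 0 0 : ℤ) : K) * (σ 1 1 : ℤ) - (σ 0 1 : ℤ) * (σ 1 0 : ℤ) = 1 := by
    exact_mod_cast congrArg (Int.cast : ℤ → K) (BinForm.det_eq σ)
  rw [← hd, BinForm.disc] at h2
  push_cast at h2
  have e1 : 2 * ((Q.act σ).a : K) * σ 1 1 - σ 1 0 * (Q.act σ).b = 2 * Q.a * σ 0 0 + Q.b * σ 1 0 := by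
    simp only [BinForm.act]; push_cast
    linear_combination (2 * (Q.a : K) * σ 0 0 + Q.b * σ 1 0) * hdet
  have e2 : (σ 0 0 : K) * (Q.act σ).b - 2 * (Q.act σ).a * σ 0 1 = Q.b * σ 0 0 + 2 * Q.c * σ 1 0 := by
    simp only [BinForm.act]; push_cast
    linear_combination ((Q.b : K) * σ 0 0 + 2 * Q.c * σ 1 0) * hdet
  have h0 : (4 * Q.a * (Q.act σ).a : K) ≠ 0 := by
    have h3 : (Q.a : K) ≠ 0 := by exact_mod_cast ha.ne'
    have h4 : ((Q.act σ).a : K) ≠ 0 := by exact_mod_cast ha'.ne'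
    simp [h3, h4]
  refine mul_left_cancel₀ h0 ?_
  generalize (Q.act σ).a = a' at *
  generalize (Q.act σ).b = b' at *
  generalize G.omega (Q.act σ) = w' at *
  linear_combination (σ 1 0 * (2 * a' * w') + 2 * a' * σ 1 1 : K) * h1
    + ((G.δ - Q.b) * σ 1 0 - 2 * Q.a * σ 0 0 : K) * h1' + (σ 1 0 : K) * h2
    + (G.δ - Q.b) * e1 + 2 * (Q.a : K) * e2

end QuadGen

end Lattices

/-! ### Fractional ideals prime to 𝔫 in a Dedekind domain. -/

section DedekindDomain

variable {R : Type*} [CommRing R] [IsDedekindDomain R] {F : Type*} [Field F] [Algebra R F]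
  [IsFractionRing R F]

open IsDedekindDomain

theorem FractionalIdeal.count_coeIdeal_eq_zero_iff (v : HeightOneSpectrum R) {J : Ideal R}
    (hJ : J ≠ ⊥) : FractionalIdeal.count F v (J : FractionalIdeal R⁰ F) = 0 ↔ ¬ J ≤ v.asIdeal := by
  classical
  rw [FractionalIdeal.count_coe F v hJ, Nat.cast_eq_zero, ← Ideal.dvd_iff_le, ← not_iff_not, not_not]
  exact Associates.count_ne_zero_iff_dvd hJ v.irreducible

/-- A fractional ideal prime to `𝔫` is a quotient of integral ideals prime to `𝔫`. -/
theorem FractionalIdeal.exists_mul_coeIdeal_eq {𝔫 : Ideal R} (h𝔫 : 𝔫 ≠ ⊥)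
    {I : FractionalIdeal R⁰ F} (hI : I ≠ 0)
    (h : ∀ v : HeightOneSpectrum R, v.asIdeal ∣ 𝔫 → FractionalIdeal.count F v I = 0) :
    ∃ A B : Ideal R, A ≠ ⊥ ∧ B ≠ ⊥ ∧ IsCoprime A 𝔫 ∧ IsCoprime B 𝔫 ∧
      I * (B : FractionalIdeal R⁰ F) = A := by
  obtain ⟨a, J, ha, hIJ⟩ := FractionalIdeal.exists_eq_spanSingleton_mul I
  have ha' : algebraMap R F a ≠ 0 := by simpa using ha
  obtain ⟨A, B, hA, hB, hAB⟩ := extract_gcd J (Ideal.span {a})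
  set g := gcd J (Ideal.span {a})
  have hcop : IsCoprime A B := Ideal.isCoprime_iff_gcd.mpr (by
    rw [← normalize_gcd A B]
    exact normalize_eq_one.mpr hAB)
  have hspan : Ideal.span {a} ≠ ⊥ := by simpa using ha
  have hg : g ≠ 0 := by
    intro h0
    rw [h0, zero_mul] at hB
    exact hspan hB
  have hB0 : B ≠ ⊥ := by
    intro h0
    rw [h0, Ideal.mul_bot] at hB
    exact hspan hB
  have h1 : I * (Ideal.span {a} : Ideal R) = (J : FractionalIdeal R⁰ F) := by
    rw [hIJ, FractionalIdeal.coeIdeal_span_singleton, mul_right_comm,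
      FractionalIdeal.spanSingleton_mul_spanSingleton, inv_mul_cancel₀ ha',
      FractionalIdeal.spanSingleton_one, one_mul]
  have hAB' : I * (B : FractionalIdeal R⁰ F) = A := by
    have hg' : (g : FractionalIdeal R⁰ F) ≠ 0 := FractionalIdeal.coeIdeal_ne_zero.mpr hg
    refine mul_left_cancel₀ hg' ?_
    rw [← FractionalIdeal.coeIdeal_mul, ← hA, ← h1, hB, FractionalIdeal.coeIdeal_mul]
    ring
  have hA0 : A ≠ ⊥ := by
    rw [← FractionalIdeal.coeIdeal_ne_zero (K := F), ← hAB']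
    exact mul_ne_zero hI (FractionalIdeal.coeIdeal_ne_zero.mpr hB0)
  -- I = A/B has valuation 0 at v, and A, B are coprime; so v divides both or neither, hence
  -- neither.
  have hiff : ∀ v : HeightOneSpectrum R, 𝔫 ≤ v.asIdeal → (A ≤ v.asIdeal ↔ B ≤ v.asIdeal) := by
    intro v hv
    rw [← not_iff_not, ← FractionalIdeal.count_coeIdeal_eq_zero_iff (F := F) v hA0,
      ← FractionalIdeal.count_coeIdeal_eq_zero_iff (F := F) v hB0, ← hAB',
      FractionalIdeal.count_mul F v hI (FractionalIdeal.coeIdeal_ne_zero.mpr hB0),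
      h v (Ideal.dvd_iff_le.mpr hv), zero_add]
  have hmain : ∀ v : HeightOneSpectrum R, 𝔫 ≤ v.asIdeal → A ≤ v.asIdeal → B ≤ v.asIdeal → False := by
    intro v _ h2 h3
    rw [Ideal.isCoprime_iff_sup_eq] at hcop
    exact v.isPrime.ne_top (top_le_iff.mp (hcop ▸ sup_le h2 h3))
  have hmax : ∀ C : Ideal R, ¬ IsCoprime C 𝔫 →
      ∃ v : HeightOneSpectrum R, C ≤ v.asIdeal ∧ 𝔫 ≤ v.asIdeal := by
    intro C hC
    rw [Ideal.isCoprime_iff_sup_eq] at hC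
    obtain ⟨M, hM, hle⟩ := Ideal.exists_le_maximal _ hC
    exact ⟨⟨M, hM.isPrime, fun h0 => h𝔫 (le_bot_iff.mp (h0 ▸ le_sup_right.trans hle))⟩,
      le_sup_left.trans hle, le_sup_right.trans hle⟩
  refine ⟨A, B, hA0, hB0, ?_, ?_, hAB'⟩
  · by_contra hC
    obtain ⟨v, h1, h2⟩ := hmax A hC
    exact hmain v h2 h1 ((hiff v h2).mp h1)
  · by_contra hC
    obtain ⟨v, h1, h2⟩ := hmax B hC
    exact hmain v h2 ((hiff v h2).mpr h1) h1

end DedekindDomain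

/-! ### Ray classes and the congruence l ≡* 1 mod N. -/

section RayClass

variable {K : Type*} [Field K] [NumberField K] {N : ℕ}

theorem mk_eq_mk_iff {𝔫 : Ideal (𝓞 K)} (A B : idealsPrimeTo K 𝔫) :
    (QuotientGroup.mk A : RayClassGroup K 𝔫) = QuotientGroup.mk B ↔
      ∃ l ∈ congrOne K 𝔫, ((B : (FractionalIdeal (𝓞 K)⁰ K)ˣ) : FractionalIdeal (𝓞 K)⁰ K) =
        FractionalIdeal.spanSingleton (𝓞 K)⁰ (l : K) *
          ((A : (FractionalIdeal (𝓞 K)⁰ K)ˣ) : FractionalIdeal (𝓞 K)⁰ K) := by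
  rw [QuotientGroup.eq, Subgroup.mem_subgroupOf, rayPrincipal, Subgroup.mem_map]
  refine exists_congr fun l => and_congr_right fun _ => ?_
  rw [← coe_toPrincipalIdeal, ← Units.val_mul, ← Units.ext_iff, Subgroup.coe_mul,
    Subgroup.coe_inv, eq_inv_mul_iff_mul_eq, mul_comm, eq_comm]

/-- The integer m, prime to N, serves as denominator: l = (m + Nz)/m. -/
theorem mem_congrOne_of_mul_eq {l : Kˣ} {m : ℤ} (hm0 : m ≠ 0) (hm : IsCoprime m (N : ℤ)) (z : 𝓞 K)
    (h : (m : K) * l = m + N * z) : l ∈ congrOne K (Ideal.span {(N : 𝓞 K)}) := by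
  have hmK : (m : K) ≠ 0 := by exact_mod_cast hm0
  have hco : IsCoprime (m : 𝓞 K) (N : 𝓞 K) := by
    simpa using hm.map (Int.castRingHom (𝓞 K))
  have hα : ((((m : 𝓞 K) + N * z : 𝓞 K)) : K) = m * l := by
    rw [h]; simp
  refine ⟨m + N * z, m, ?_, by exact_mod_cast hm0, ?_, ?_, ?_, ?_⟩
  · intro h0
    rw [h0] at hα
    simp [hmK] at hα
  · rw [Ideal.isCoprime_span_singleton_iff]
    exact hco.add_mul_left_left z
  · rwa [Ideal.isCoprime_span_singleton_iff]
  · rw [Ideal.mem_span_singleton]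
    exact ⟨z, by ring⟩
  · rw [hα]
    simp [hmK]

/-- With l = α/β one has β(x - m) = m(α - β), and β is invertible modulo N. -/
theorem exists_mul_eq_of_mem_congrOne {l : Kˣ} (hl : l ∈ congrOne K (Ideal.span {(N : 𝓞 K)}))
    {m x : 𝓞 K} (h : (x : K) = m * l) : ∃ z : 𝓞 K, x = m + N * z := by
  obtain ⟨α, β, hα, hβ, cα, cβ, hαβ, hl⟩ := hl
  rw [Ideal.isCoprime_span_singleton_iff] at cβ
  rw [Ideal.mem_span_singleton] at hαβ
  have hβK : (β : K) ≠ 0 := by simpa using hβ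
  have h1 : β * (x - m) = m * (α - β) := by
    apply RingOfIntegers.coe_injective
    simp only [map_mul, map_sub]
    have h2 : (β : K) * l = α := by rw [hl]; field_simp
    linear_combination (β : K) * h + (m : K) * h2
  have h2 : (N : 𝓞 K) ∣ x - m := cβ.symm.dvd_of_dvd_mul_left (h1 ▸ hαβ.mul_left m)
  obtain ⟨z, hz⟩ := h2
  exact ⟨z, by rw [← hz]; ring⟩

end RayClass

/-! ### Change of lattice under SL₂(ℤ), and the ray class of a form. -/

namespace QuadGen

variable {K : Type*} [Field K] [NumberField K] {ι : K →+* ℂ} {G : QuadGen K ι} {Q Q' : BinForm}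
  {N : ℕ}

theorem omega_combination_injective (ha : 0 < Q.a) {s t s' t' : ℤ}
    (h : (s : K) * G.omega Q + t = s' * G.omega Q + t') : s = s' ∧ t = t' :=
  int_combination_injective (im_omega_pos ha).ne' h

theorem eq_of_omega_eq (G : QuadGen K ι) (ha : 0 < Q.a) (hd : Q.disc = discr K) (ha' : 0 < Q'.a)
    (hd' : Q'.disc = discr K) (h : G.omega Q = G.omega Q') : Q = Q' := by
  have h1 := two_mul_omega (G := G) ha
  have h2 := two_mul_omega (G := G) ha'
  rw [← h] at h2
  have h3 := omega_combination_injective (G := G) ha (s := 2 * Q.a) (t := Q.b) (s' := 2 * Q'.a)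
    (t' := Q'.b) (by push_cast; linear_combination h1 - h2)
  have h4 : Q.a = Q'.a := by linarith [h3.1]
  rw [← hd', BinForm.disc, BinForm.disc, h3.2, h4] at hd
  have h5 : Q.c = Q'.c := by
    have : 4 * Q'.a * Q.c = 4 * Q'.a * Q'.c := by linarith
    exact mul_left_cancel₀ (by simpa using ha'.ne') this
  exact BinForm.ext h4 h3.2 h5

theorem automorphy_ne_zero (ha : 0 < Q.a) {u v : ℤ} (h : u ≠ 0 ∨ v ≠ 0) :
    (u : K) * G.omega Q + v ≠ 0 := by
  intro h0
  have := omega_combination_injective (G := G) ha (s := u) (t := v) (s' := 0) (t' := 0) (by simpa using h0)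
  tauto

theorem row_ne_zero (σ : SL(2, ℤ)) : σ 1 0 ≠ 0 ∨ σ 1 1 ≠ 0 := by
  by_contra! h
  have := BinForm.det_eq σ
  simp [h] at this

/-- Multiplying the basis ω_Q, 1 by the automorphy factor gives the σ-transform of the basis
ω_{Q^σ}, 1, and σ is unimodular. -/
theorem latticeIdeal_act (hQ : Q.IsPosDef) (hd : Q.disc = discr K) (σ : SL(2, ℤ)) :
    G.latticeIdeal (Q.act σ) =
      FractionalIdeal.spanSingleton (𝓞 K)⁰ (σ 1 0 * G.omega (Q.act σ) + σ 1 1 : K) *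
        G.latticeIdeal Q := by
  have hw := omega_mul_act (G := G) hQ hd σ
  have hdet : ((σ 0 0 : ℤ) : K) * (σ 1 1 : ℤ) - (σ 0 1 : ℤ) * (σ 1 0 : ℤ) = 1 := by
    exact_mod_cast congrArg (Int.cast : ℤ → K) (BinForm.det_eq σ)
  ext x
  simp only [FractionalIdeal.mem_singleton_mul, mem_latticeIdeal hQ.a_pos hd,
    mem_latticeIdeal (act_a_pos hQ σ) ((Q.disc_act σ).trans hd)]
  constructor
  · rintro ⟨s, t, rfl⟩
    refine ⟨_, ⟨s * σ 1 1 - t * σ 1 0, t * σ 0 0 - s * σ 0 1, rfl⟩, ?_⟩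
    push_cast
    linear_combination (-(s * σ 1 1 - t * σ 1 0 : K)) * hw -
      (s * G.omega (Q.act σ) + t : K) * hdet
  · rintro ⟨_, ⟨s, t, rfl⟩, rfl⟩
    refine ⟨s * σ 0 0 + t * σ 1 0, s * σ 0 1 + t * σ 1 1, ?_⟩
    push_cast
    linear_combination (s : K) * hw

/-- From 𝓞_K ⊆ [ω_Q, 1] ⊆ a⁻¹𝓞_K, the valuation at v ∣ N is squeezed to 0 because a is a unit there.
-/
theorem latticeIdeal_mem_idealsPrimeTo (ha : 0 < Q.a) (hd : Q.disc = discr K)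
    (hN : Int.gcd N Q.a = 1) :
    Units.mk0 (G.latticeIdeal Q) latticeIdeal_ne_zero ∈
      idealsPrimeTo K (Ideal.span {(N : 𝓞 K)}) := by
  intro v hv
  have haO : (Q.a : 𝓞 K) ≠ 0 := by exact_mod_cast ha.ne'
  have hspan : Ideal.span {(Q.a : 𝓞 K)} ≠ ⊥ := by simpa using haO
  have hav : ¬ Ideal.span {(Q.a : 𝓞 K)} ≤ v.asIdeal := by
    intro h
    rw [Ideal.dvd_iff_le, Ideal.span_singleton_le_iff_mem] at hv
    rw [Ideal.span_singleton_le_iff_mem] at h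
    obtain ⟨x, y, hxy⟩ := Int.isCoprime_iff_gcd_eq_one.mpr hN
    have hxy' : (x : 𝓞 K) * N + y * Q.a = 1 := by exact_mod_cast congrArg (Int.cast : ℤ → 𝓞 K) hxy
    exact v.isPrime.ne_top ((Ideal.eq_top_iff_one _).mpr
      (hxy' ▸ v.asIdeal.add_mem (v.asIdeal.mul_mem_left _ hv) (v.asIdeal.mul_mem_left _ h)))
  have hc := (FractionalIdeal.count_coeIdeal_eq_zero_iff (F := K) v hspan).mpr hav
  have hspan' : ((Ideal.span {(Q.a : 𝓞 K)} : Ideal (𝓞 K)) : FractionalIdeal (𝓞 K)⁰ K) ≠ 0 :=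
    FractionalIdeal.coeIdeal_ne_zero.mpr hspan
  rw [Units.val_mk0]
  apply le_antisymm
  · rw [← FractionalIdeal.count_one K v]
    exact FractionalIdeal.count_mono K v one_ne_zero one_le_latticeIdeal
  · have hle : ((Ideal.span {(Q.a : 𝓞 K)} : Ideal (𝓞 K)) : FractionalIdeal (𝓞 K)⁰ K) *
        G.latticeIdeal Q ≤ 1 := by
      rw [FractionalIdeal.coeIdeal_span_singleton]
      intro x hx
      obtain ⟨y, hy, rfl⟩ := FractionalIdeal.mem_singleton_mul.mp hx
      obtain ⟨z, hz⟩ := mul_mem_latticeIdeal ha hd hy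
      exact (FractionalIdeal.mem_one_iff _).mpr ⟨z, by simpa using hz⟩
    have := FractionalIdeal.count_mono K v (mul_ne_zero hspan' latticeIdeal_ne_zero) hle
    rwa [FractionalIdeal.count_mul K v hspan' latticeIdeal_ne_zero, hc, zero_add,
      FractionalIdeal.count_one] at this

variable (G) in
/-- The lattice `[ω_Q, 1]` as a fractional ideal prime to `N`. -/
noncomputable def idealOfForm (Q : FormsPrimeTo N (discr K)) :
    idealsPrimeTo K (Ideal.span {(N : 𝓞 K)}) :=
  ⟨_, latticeIdeal_mem_idealsPrimeTo (G := G) Q.2.2.1.a_pos Q.2.2.2.1 Q.2.2.2.2⟩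

theorem coe_idealOfForm (Q : FormsPrimeTo N (discr K)) :
    ((G.idealOfForm Q : (FractionalIdeal (𝓞 K)⁰ K)ˣ) : FractionalIdeal (𝓞 K)⁰ K) =
      G.latticeIdeal Q.1 := rfl

variable (G) in
/-- The ray class of `[ω_Q, 1]`. -/
noncomputable def rayClass (Q : FormsPrimeTo N (discr K)) :
    RayClassGroup K (Ideal.span {(N : 𝓞 K)}) := QuotientGroup.mk (G.idealOfForm Q)

end QuadGen

/-! ### Well-definedness and injectivity of the class map. -/

/-- From Im z · |uζ + v|² = (rv - su) · Im ζ. -/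
theorem moebius_det_nonneg {z ζ : ℂ} (hz : 0 < z.im) (hζ : 0 < ζ.im) {r s u v : ℤ}
    (h : z * (u * ζ + v) = r * ζ + s) : 0 ≤ r * v - s * u := by
  have hre := congrArg Complex.re h
  have him := congrArg Complex.im h
  simp at hre him
  have key : z.im * ((u * ζ.re + v) ^ 2 + (u * ζ.im) ^ 2) = ((r : ℝ) * v - s * u) * ζ.im := by
    linear_combination (u * ζ.re + v : ℝ) * him - (u * ζ.im : ℝ) * hre
  have h1 : 0 ≤ ((r : ℝ) * v - s * u) * ζ.im := by rw [← key]; positivity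
  have h2 : (0 : ℝ) ≤ (r : ℝ) * v - s * u := nonneg_of_mul_nonneg_left h1 hζ
  exact_mod_cast h2

theorem mem_Gamma1_iff_dvd {N : ℕ} {σ : SL(2, ℤ)} :
    σ ∈ CongruenceSubgroup.Gamma1 N ↔ (N : ℤ) ∣ σ 1 0 ∧ (N : ℤ) ∣ σ 1 1 - 1 := by
  have e : ∀ x : ℤ, (x : ZMod N) = 1 ↔ (N : ℤ) ∣ x - 1 := by
    intro x
    rw [← ZMod.intCast_zmod_eq_zero_iff_dvd, Int.cast_sub, Int.cast_one, sub_eq_zero]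
  rw [CongruenceSubgroup.Gamma1_mem, e, e, ZMod.intCast_zmod_eq_zero_iff_dvd]
  refine ⟨fun h => ⟨h.2.2, h.2.1⟩, fun h => ⟨?_, h.2, h.1⟩⟩
  have hdet := BinForm.det_eq σ
  have : σ 0 0 - 1 = σ 0 1 * σ 1 0 - σ 0 0 * (σ 1 1 - 1) := by linear_combination hdet
  rw [this]
  exact dvd_sub (h.1.mul_left _) (h.2.mul_left _)

namespace QuadGen

variable {K : Type*} [Field K] [NumberField K] {ι : K →+* ℂ} {G : QuadGen K ι} {N : ℕ}

/-- The two lattices differ by j = uω_{Q'} + v, and a'j = u(θ - k) + a'v ≡ a' mod N. -/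
theorem rayClass_eq_of_act_Gamma1 {Q Q' : FormsPrimeTo N (discr K)} {σ : SL(2, ℤ)}
    (hσ : σ ∈ CongruenceSubgroup.Gamma1 N) (h : Q'.1 = Q.1.act σ) :
    G.rayClass Q = G.rayClass Q' := by
  obtain ⟨⟨u₁, hu⟩, ⟨v₁, hv⟩⟩ := mem_Gamma1_iff_dvd.mp hσ
  have ha' := Q'.2.2.1.a_pos
  obtain ⟨k, hk⟩ := exists_theta_eq (G := G) ha' Q'.2.2.2.1
  have hj := automorphy_ne_zero (G := G) ha' (row_ne_zero σ)
  refine (mk_eq_mk_iff _ _).mpr ⟨Units.mk0 _ hj, ?_, ?_⟩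
  · refine mem_congrOne_of_mul_eq ha'.ne' ?_ (u₁ * (G.θ - k) + Q'.1.a * v₁) ?_
    · exact (Int.isCoprime_iff_gcd_eq_one.mpr Q'.2.2.2.2).symm
    · have hv' : σ 1 1 = 1 + N * v₁ := by linarith
      simp only [Units.val_mk0, hu, hv', map_add, map_mul, map_sub, map_intCast]
      push_cast
      linear_combination (-(N * u₁) : K) * hk
  · rw [coe_idealOfForm, coe_idealOfForm, Units.val_mk0, h, latticeIdeal_act Q.2.2.1 Q.2.2.2.1]

theorem rayClass_eq_of_equiv {Q Q' : FormsPrimeTo N (discr K)} {σ : SL(2, ℤ)}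
    (hσ : σ ∈ pmGamma1 N) (h : Q'.1 = Q.1.act σ) : G.rayClass Q = G.rayClass Q' := by
  rcases hσ with hσ | hσ
  · exact rayClass_eq_of_act_Gamma1 hσ h
  · exact rayClass_eq_of_act_Gamma1 hσ (by rw [BinForm.act_neg, h])

/-- Multiplication by l carries the basis ω_Q, 1 to a basis of [ω_{Q'}, 1], so the transition matrix
is invertible over ℤ; both points lie in the upper half-plane, so its determinant is 1. -/
theorem exists_act_eq_of_latticeIdeal_eq {Q Q' : BinForm} (hQ : Q.IsPosDef)
    (hd : Q.disc = discr K) (hQ' : Q'.IsPosDef) (hd' : Q'.disc = discr K) {l : K}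
    (h : G.latticeIdeal Q' = FractionalIdeal.spanSingleton (𝓞 K)⁰ l * G.latticeIdeal Q) :
    ∃ σ : SL(2, ℤ), Q' = Q.act σ ∧ l = σ 1 0 * G.omega Q' + σ 1 1 := by
  have ha := hQ.a_pos
  have ha' := hQ'.a_pos
  have hto : ∀ x ∈ G.latticeIdeal Q, l * x ∈ G.latticeIdeal Q' := fun x hx => by
    rw [h]; exact FractionalIdeal.mem_singleton_mul.mpr ⟨x, hx, rfl⟩
  have hfrom : ∀ y ∈ G.latticeIdeal Q', ∃ x ∈ G.latticeIdeal Q, y = l * x := fun y hy => by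
    rw [h] at hy; exact FractionalIdeal.mem_singleton_mul.mp hy
  obtain ⟨u, v, huv⟩ := (mem_latticeIdeal ha' hd').mp (hto _ one_mem_latticeIdeal)
  obtain ⟨r, s, hrs⟩ := (mem_latticeIdeal ha' hd').mp (hto _ omega_mem_latticeIdeal)
  obtain ⟨x, hx, hx1⟩ := hfrom _ omega_mem_latticeIdeal
  obtain ⟨p, q, rfl⟩ := (mem_latticeIdeal ha hd).mp hx
  obtain ⟨y, hy, hy1⟩ := hfrom _ one_mem_latticeIdeal
  obtain ⟨m, n, rfl⟩ := (mem_latticeIdeal ha hd).mp hy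
  rw [mul_one] at huv
  have e1 := omega_combination_injective (G := G) ha' (s := 1) (t := 0) (s' := p * r + q * u)
    (t' := p * s + q * v) (by
      push_cast
      linear_combination hx1 + (p : K) * hrs + (q : K) * huv)
  have e2 := omega_combination_injective (G := G) ha' (s := 0) (t := 1) (s' := m * r + n * u)
    (t' := m * s + n * v) (by
      push_cast
      linear_combination hy1 + (m : K) * hrs + (n : K) * huv)
  have hw : G.omega Q * (u * G.omega Q' + v) = r * G.omega Q' + s := by
    rw [← huv, ← hrs, mul_comm]
  have hdet : r * v - s * u = 1 := by
    have h0 : 0 ≤ r * v - s * u := by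
      refine moebius_det_nonneg (im_omega_pos (G := G) ha) (im_omega_pos (G := G) ha') ?_
      simpa using congrArg ι hw
    have h1 : (r * v - s * u) * (p * n - q * m) = 1 := by
      linear_combination -(m * s + n * v) * e1.1 + (m * r + n * u) * e1.2 - e2.2
    exact Int.eq_one_of_mul_eq_one_right h0 h1
  let σ : SL(2, ℤ) := ⟨!![r, s; u, v], by rw [Matrix.det_fin_two_of, hdet]⟩
  refine ⟨σ, ?_, huv⟩
  refine G.eq_of_omega_eq ha' hd' (act_a_pos hQ σ) ((Q.disc_act σ).trans hd) ?_
  have hw' : G.omega Q * (u * G.omega (Q.act σ) + v) = r * G.omega (Q.act σ) + s :=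
    omega_mul_act (G := G) hQ hd σ
  -- Both ω_{Q'} and ω_{Q^σ} solve (uω_Q - r)X = s - vω_Q, so a nonzero coefficient makes them
  -- equal.
  have hne : (u : K) * G.omega Q - r ≠ 0 := by
    intro h0
    have := omega_combination_injective (G := G) ha (s := u) (t := -r) (s' := 0) (t' := 0)
      (by push_cast; linear_combination h0)
    rw [this.1, neg_eq_zero.mp this.2] at hdet
    simp at hdet
  refine mul_left_cancel₀ hne ?_
  linear_combination hw - hw'

theorem exists_act_eq_of_rayClass_eq {Q Q' : FormsPrimeTo N (discr K)}
    (h : G.rayClass Q = G.rayClass Q') : ∃ σ ∈ pmGamma1 N, Q'.1 = Q.1.act σ := by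
  obtain ⟨l, hl, h⟩ := (mk_eq_mk_iff _ _).mp h
  rw [coe_idealOfForm, coe_idealOfForm] at h
  obtain ⟨σ, hσ, hlσ⟩ := exists_act_eq_of_latticeIdeal_eq Q.2.2.1 Q.2.2.2.1 Q'.2.2.1 Q'.2.2.2.1 h
  refine ⟨σ, Or.inl (mem_Gamma1_iff_dvd.mpr ?_), hσ⟩
  obtain ⟨k, hk⟩ := exists_theta_eq (G := G) Q'.2.2.1.a_pos Q'.2.2.2.1
  obtain ⟨z, hz⟩ := exists_mul_eq_of_mem_congrOne hl (m := (Q'.1.a : 𝓞 K))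
    (x := σ 1 0 * (G.θ - k) + Q'.1.a * σ 1 1) (by
      rw [hlσ]
      simp only [map_add, map_mul, map_sub, map_intCast]
      linear_combination (σ 1 0 : K) * hk)
  obtain ⟨s, t, rfl⟩ := G.span z
  have hz' := congrArg (fun x : 𝓞 K => (x : K)) hz
  simp only [map_add, map_mul, map_sub, map_intCast, map_natCast] at hz'
  -- Coordinates of a'l = a' + Nz in the basis 1, θ: N divides u, and then a'(v - 1), where a' is
  -- prime to N.
  have hc := G.eq_of_combination_eq (s := Q'.1.a * σ 1 1 - σ 1 0 * k) (t := σ 1 0)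
    (s' := Q'.1.a + N * s) (t' := N * t) (by push_cast; linear_combination hz')
  refine ⟨⟨t, hc.2⟩, ?_⟩
  have hco := Int.isCoprime_iff_gcd_eq_one.mpr Q'.2.2.2.2
  refine hco.dvd_of_dvd_mul_left (z := σ 1 1 - 1) ⟨s + t * k, ?_⟩
  linear_combination hc.1 + k * hc.2

/-! ### Surjectivity of the class map. -/

/-- An ideal coprime to `N` contains a nonzero integer congruent to `1` modulo `N`. -/
theorem exists_int_mem_of_isCoprime (G : QuadGen K ι) (hN : 0 < N) {J : Ideal (𝓞 K)} (hJ : J ≠ ⊥)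
    (h : IsCoprime J (Ideal.span {(N : 𝓞 K)})) :
    ∃ m m' : ℤ, m ≠ 0 ∧ m = 1 + N * m' ∧ (m : 𝓞 K) ∈ J := by
  obtain ⟨b, hb, c, hc, hbc⟩ := Ideal.isCoprime_iff_exists.mp h
  obtain ⟨z, rfl⟩ := Ideal.mem_span_singleton.mp hc
  obtain ⟨s, t, rfl⟩ := G.span z
  -- With b = 1 - Nz ∈ J, the integer 1 + Nm' is the norm of b: m' is N times the norm of z minus
  -- its trace.
  set m' : ℤ := N * (s ^ 2 + s * t * G.T + t ^ 2 * G.n) - (2 * s + t * G.T) with hm'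
  have hmem : ((1 + N * m' : ℤ) : 𝓞 K) ∈ J := by
    have : ((1 + N * m' : ℤ) : 𝓞 K) = (1 - N * (s + t * (G.T - G.θ))) * b := by
      rw [hm']
      push_cast
      linear_combination (1 - N * (s + t * (G.T - G.θ)) : 𝓞 K) * (-hbc) +
        (N ^ 2 * t ^ 2 : 𝓞 K) * G.θ_sq
    rw [this]
    exact J.mul_mem_left _ hb
  -- A vanishing norm is repaired by adding N times the absolute norm of J, which lies in J too.
  by_cases h0 : 1 + N * m' = 0
  · have hn : Ideal.absNorm J ≠ 0 := by rwa [Ne, Ideal.absNorm_eq_zero_iff]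
    refine ⟨1 + N * (m' + Ideal.absNorm J), m' + Ideal.absNorm J, ?_, rfl, ?_⟩
    · rw [mul_add, ← add_assoc, h0, zero_add]
      exact_mod_cast (mul_ne_zero hN.ne' hn)
    · have : ((1 + N * (m' + Ideal.absNorm J) : ℤ) : 𝓞 K) =
          ((1 + N * m' : ℤ) : 𝓞 K) + N * (Ideal.absNorm J : 𝓞 K) := by push_cast; ring
      rw [this]
      exact J.add_mem hmem (J.mul_mem_left _ (Ideal.absNorm_mem J))
  · exact ⟨_, m', h0, rfl, hmem⟩

/-- A nonzero ideal has a positively oriented generating pair. -/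
theorem exists_oriented_generators [Algebra.IsQuadraticExtension ℚ K] (G : QuadGen K ι)
    {J : Ideal (𝓞 K)} (hJ : J ≠ ⊥) :
    ∃ e₁ ∈ J, ∃ e₂ ∈ J, (∀ x ∈ J, ∃ s t : ℤ, x = s * e₁ + t * e₂) ∧
      0 < (ι (e₁ : K) * (starRingEnd ℂ) (ι (e₂ : K))).im := by
  have hrank : Module.finrank ℤ (𝓞 K) = 2 := by
    rw [RingOfIntegers.rank, Algebra.IsQuadraticExtension.finrank_eq_two]
  let b := J.selfBasis (Module.finBasisOfFinrankEq ℤ (𝓞 K) hrank) hJ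
  have hspan : ∀ x ∈ J, ∃ s t : ℤ, x = s * (b 0 : 𝓞 K) + t * (b 1 : 𝓞 K) := by
    intro x hx
    refine ⟨b.repr ⟨x, hx⟩ 0, b.repr ⟨x, hx⟩ 1, ?_⟩
    have := congrArg (fun y : J => (y : 𝓞 K)) (b.sum_repr ⟨x, hx⟩)
    rw [Fin.sum_univ_two] at this
    simp only [Submodule.coe_add, Submodule.coe_smul_of_tower, zsmul_eq_mul] at this
    exact this.symm
  -- With M the absolute norm, J contains M and Mθ, which span the oriented area M² Im θ ≠ 0 up to
  -- sign; this is an integer multiple of the area of the basis.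
  have hne : (ι ((b 0 : 𝓞 K) : K) * (starRingEnd ℂ) (ι ((b 1 : 𝓞 K) : K))).im ≠ 0 := by
    intro h0
    have hn : Ideal.absNorm J ≠ 0 := by rwa [Ne, Ideal.absNorm_eq_zero_iff]
    have hM := Ideal.absNorm_mem J
    obtain ⟨s, t, h1⟩ := hspan _ hM
    obtain ⟨s', t', h2⟩ := hspan _ (J.mul_mem_left G.θ hM)
    have hre := congrArg (fun x : 𝓞 K => (ι (x : K)).re) h1
    have him := congrArg (fun x : 𝓞 K => (ι (x : K)).im) h1
    have him' := congrArg (fun x : 𝓞 K => (ι (x : K)).im) h2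
    simp at h0 hre him him'
    have h3 : (Ideal.absNorm J : ℝ) ^ 2 * (ι (G.θ : K)).im = 0 := by
      linear_combination (Ideal.absNorm J : ℝ) * him' +
        (s' * (ι ((b 0 : 𝓞 K) : K)).im + t' * (ι ((b 1 : 𝓞 K) : K)).im) * hre +
        (s' * (ι ((b 0 : 𝓞 K) : K)).re + t' * (ι ((b 1 : 𝓞 K) : K)).re) * (-him) +
        (s' * t - s * t' : ℝ) * h0
    have h4 : (Ideal.absNorm J : ℝ) ≠ 0 := by exact_mod_cast hn
    have h5 := G.im_pos
    have : 0 < (Ideal.absNorm J : ℝ) ^ 2 * (ι (G.θ : K)).im := by positivity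
    exact this.ne' h3
  rcases lt_or_gt_of_ne hne with h | h
  · refine ⟨-(b 0 : 𝓞 K), J.neg_mem (b 0).2, b 1, (b 1).2, fun x hx => ?_, ?_⟩
    · obtain ⟨s, t, h⟩ := hspan x hx
      exact ⟨-s, t, by rw [h]; push_cast; ring⟩
    · simp at h ⊢
      linarith
  · exact ⟨b 0, (b 0).2, b 1, (b 1).2, hspan, h⟩

end QuadGen

namespace QuadGen

variable {K : Type*} [Field K] [NumberField K] {ι : K →+* ℂ} {G : QuadGen K ι} {N : ℕ}

/-- A positively oriented generating pair `ξ, ν` of an ideal is, up to the factor `ν`, the pair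
`ω_Q, 1` of a form `Q`. -/
theorem exists_form_of_oriented_generators (G : QuadGen K ι) {J : Ideal (𝓞 K)} {ξ ν : 𝓞 K}
    (hξ : ξ ∈ J) (hν : ν ∈ J) (hspan : ∀ x ∈ J, ∃ s t : ℤ, x = s * ξ + t * ν)
    (him : 0 < (ι (ξ : K) * (starRingEnd ℂ) (ι (ν : K))).im) :
    ∃ Q : BinForm, 0 < Q.a ∧ Q.disc = discr K ∧ (ξ : K) = ν * G.omega Q ∧
      ∃ k : ℤ, (G.θ - k) * ν = Q.a * ξ := by
  have hν0 : ν ≠ 0 := by rintro rfl; simp at him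
  have hξ0 : ξ ≠ 0 := by rintro rfl; simp at him
  have hνK : (ν : K) ≠ 0 := by simpa using hν0
  -- These are the entries of multiplication by θ on the basis ξ, ν. Its trace k + e is T and its
  -- determinant ke - af is n, so the form (a, k - e, -f) has discriminant T² - 4n.
  obtain ⟨a, k, hak⟩ := hspan _ (J.mul_mem_left G.θ hν)
  obtain ⟨e, f, hef⟩ := hspan _ (J.mul_mem_left G.θ hξ)
  have hθ : (G.θ - k) * (G.θ - e) = a * f := by
    refine mul_right_cancel₀ (mul_ne_zero hξ0 hν0) ?_
    linear_combination (G.θ - e) * ξ * hak + (a * ξ : 𝓞 K) * hef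
  have hθK := congrArg (fun x : 𝓞 K => (x : K)) hθ
  simp only [map_mul, map_sub, map_intCast] at hθK
  have hc := G.eq_of_combination_eq (s := -G.n) (t := G.T) (s' := a * f - k * e) (t' := k + e) (by
    push_cast
    linear_combination hθK - G.sq_coe)
  have hakK := congrArg (fun x : 𝓞 K => (x : K)) hak
  simp only [map_mul, map_add, map_intCast] at hakK
  -- Multiplying θν = aξ + kν by the conjugate of ν and taking imaginary parts shows that a has the
  -- sign of the orientation.
  have ha : 0 < a := by
    have h1 : ι (G.θ : K) * Complex.normSq (ι (ν : K)) =
        a * (ι (ξ : K) * (starRingEnd ℂ) (ι (ν : K))) + k * Complex.normSq (ι (ν : K)) := by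
      rw [← Complex.mul_conj]
      have h2 := congrArg ι hakK
      simp only [map_mul, map_add, map_intCast] at h2
      linear_combination (starRingEnd ℂ) (ι (ν : K)) * h2
    have h2 := congrArg Complex.im h1
    rw [Complex.im_mul_ofReal, Complex.add_im, ← Complex.ofReal_intCast, ← Complex.ofReal_intCast,
      Complex.im_ofReal_mul, ← Complex.ofReal_mul, Complex.ofReal_im, add_zero] at h2
    have h3 : 0 < Complex.normSq (ι (ν : K)) := Complex.normSq_pos.mpr (by simpa using hν0)
    have h4 : (0 : ℝ) < a := by
      refine pos_of_mul_pos_left (b := (ι (ξ : K) * (starRingEnd ℂ) (ι (ν : K))).im) ?_ him.le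
      rw [← h2]
      exact mul_pos G.im_pos h3
    exact_mod_cast h4
  refine ⟨⟨a, k - e, -f⟩, ha, ?_, ?_, k, ?_⟩
  · rw [G.discr_eq, BinForm.disc, hc.2]
    linear_combination -4 * hc.1
  · have h1 := two_mul_omega (G := G) (Q := ⟨a, k - e, -f⟩) ha
    have hT : (G.T : K) = k + e := by exact_mod_cast hc.2
    have ha' : (2 * a : K) ≠ 0 := by exact_mod_cast (by simpa using ha.ne' : 2 * a ≠ 0)
    refine mul_left_cancel₀ ha' ?_
    simp only [δ] at h1
    push_cast at h1
    linear_combination (-(ν : K)) * h1 - 2 * hakK + (ν : K) * hT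
  · linear_combination hak

/-- Write I = A/B with A, B prime to N. An integer m ≡ 1 in B clears the denominator, and A ⊆ I, so
m times an integer ≡ 1 in A lies in J = mI. -/
theorem exists_scaled_ideal (G : QuadGen K ι) (hN : 0 < N)
    (I : idealsPrimeTo K (Ideal.span {(N : 𝓞 K)})) :
    ∃ (m m' : ℤ) (J : Ideal (𝓞 K)) (n n' : ℤ), m ≠ 0 ∧ m = 1 + N * m' ∧ n = 1 + N * n' ∧ J ≠ ⊥ ∧
      (J : FractionalIdeal (𝓞 K)⁰ K) = FractionalIdeal.spanSingleton (𝓞 K)⁰ (m : K) *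
        ((I : (FractionalIdeal (𝓞 K)⁰ K)ˣ) : FractionalIdeal (𝓞 K)⁰ K) ∧ (n : 𝓞 K) ∈ J := by
  have h𝔫 : Ideal.span {(N : 𝓞 K)} ≠ ⊥ := by simpa using hN.ne'
  have hI0 := (I : (FractionalIdeal (𝓞 K)⁰ K)ˣ).ne_zero
  obtain ⟨A, B, hA, hB, cA, cB, hAB⟩ := FractionalIdeal.exists_mul_coeIdeal_eq h𝔫 hI0 I.2
  set I' : FractionalIdeal (𝓞 K)⁰ K := ((I : (FractionalIdeal (𝓞 K)⁰ K)ˣ) : FractionalIdeal (𝓞 K)⁰ K)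
  obtain ⟨m, m', hm0, hm, hmB⟩ := G.exists_int_mem_of_isCoprime hN hB cB
  obtain ⟨n, n', hn0, hn, hnA⟩ := G.exists_int_mem_of_isCoprime hN hA cA
  have hmB' : FractionalIdeal.spanSingleton (𝓞 K)⁰ (m : K) ≤ (B : FractionalIdeal (𝓞 K)⁰ K) := by
    rw [FractionalIdeal.spanSingleton_le_iff_mem]
    exact (FractionalIdeal.mem_coeIdeal _).mpr ⟨m, hmB, by simp⟩
  have hle : FractionalIdeal.spanSingleton (𝓞 K)⁰ (m : K) * I' ≤ 1 :=
    calc _ ≤ (B : FractionalIdeal (𝓞 K)⁰ K) * I' := mul_le_mul_left hmB' I'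
      _ = A := by rw [mul_comm, hAB]
      _ ≤ 1 := FractionalIdeal.coeIdeal_le_one
  obtain ⟨J, hJ⟩ := FractionalIdeal.le_one_iff_exists_coeIdeal.mp hle
  have hmK : (m : K) ≠ 0 := by exact_mod_cast hm0
  have hnI : (n : K) ∈ I' := by
    have h1 : (A : FractionalIdeal (𝓞 K)⁰ K) ≤ I' := by
      rw [← hAB]
      calc _ ≤ I' * 1 := mul_le_mul_right FractionalIdeal.coeIdeal_le_one I'
        _ = I' := mul_one _
    exact h1 ((FractionalIdeal.mem_coeIdeal _).mpr ⟨n, hnA, by simp⟩)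
  refine ⟨m, m', J, m * n, m' + n' + N * m' * n', hm0, hm, ?_, ?_, hJ, ?_⟩
  · rw [hm, hn]; ring
  · rw [← FractionalIdeal.coeIdeal_ne_zero (K := K), hJ]
    exact mul_ne_zero (FractionalIdeal.spanSingleton_ne_zero_iff.mpr hmK) hI0
  · have h1 : ((m * n : ℤ) : K) ∈ (J : FractionalIdeal (𝓞 K)⁰ K) := by
      rw [hJ]
      exact FractionalIdeal.mem_singleton_mul.mpr ⟨n, hnI, by push_cast; rfl⟩
    obtain ⟨x, hx, hx'⟩ := (FractionalIdeal.mem_coeIdeal _).mp h1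
    have : x = ((m * n : ℤ) : 𝓞 K) := by
      apply RingOfIntegers.coe_injective
      simpa using hx'
    rwa [← this]

theorem latticeIdeal_eq_of_generators {Q : BinForm} (ha : 0 < Q.a) (hd : Q.disc = discr K)
    {J : Ideal (𝓞 K)} {ξ ν : 𝓞 K} (hξ : ξ ∈ J) (hν : ν ∈ J) (hν0 : ν ≠ 0)
    (hspan : ∀ x ∈ J, ∃ s t : ℤ, x = s * ξ + t * ν) (h : (ξ : K) = ν * G.omega Q) :
    G.latticeIdeal Q = FractionalIdeal.spanSingleton (𝓞 K)⁰ (ν : K)⁻¹ *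
      (J : FractionalIdeal (𝓞 K)⁰ K) := by
  have hνK : (ν : K) ≠ 0 := by simpa using hν0
  ext x
  rw [mem_latticeIdeal ha hd, FractionalIdeal.mem_singleton_mul]
  constructor
  · rintro ⟨s, t, rfl⟩
    refine ⟨((s * ξ + t * ν : 𝓞 K) : K), (FractionalIdeal.mem_coeIdeal _).mpr
      ⟨_, J.add_mem (J.mul_mem_left _ hξ) (J.mul_mem_left _ hν), rfl⟩, ?_⟩
    simp only [map_add, map_mul, map_intCast]
    rw [eq_inv_mul_iff_mul_eq₀ hνK]
    linear_combination (-s : K) * h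
  · rintro ⟨_, hy, rfl⟩
    obtain ⟨y, hyJ, rfl⟩ := (FractionalIdeal.mem_coeIdeal _).mp hy
    obtain ⟨s, t, rfl⟩ := hspan y hyJ
    refine ⟨s, t, ?_⟩
    simp only [map_add, map_mul, map_intCast]
    rw [inv_mul_eq_iff_eq_mul₀ hνK]
    linear_combination (s : K) * h

theorem rayClass_surjective [Algebra.IsQuadraticExtension ℚ K] (G : QuadGen K ι) (hN : 0 < N) :
    Function.Surjective (G.rayClass : FormsPrimeTo N (discr K) → _) := by
  intro c
  obtain ⟨I, rfl⟩ := QuotientGroup.mk_surjective c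
  obtain ⟨m, m', J, n, n', hm0, hm, hn, hJ, hJI, hnJ⟩ := G.exists_scaled_ideal hN I
  obtain ⟨e₁, he₁, e₂, he₂, hspan, him⟩ := G.exists_oriented_generators hJ
  obtain ⟨x, y, hxy⟩ := hspan _ hnJ
  have hN0 : (N : ℤ) ≠ 0 := by exact_mod_cast hN.ne'
  -- A prime dividing x, y and N would divide n - Nn' = 1 in 𝓞_K.
  obtain ⟨σ, hσ0, hσ1⟩ := exists_SL2_row_modEq (u := x) (v := y) hN0 (by
    rintro p hp ⟨x', hx⟩ ⟨y', hy⟩ ⟨q, hq⟩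
    have hq' : (N : 𝓞 K) = p * q := by exact_mod_cast congrArg (Int.cast : ℤ → 𝓞 K) hq
    refine natCast_mul_ne_one hp (x' * e₁ + y' * e₂ - q * n' : 𝓞 K) ?_
    rw [hx, hy, hn] at hxy
    push_cast at hxy
    rw [hq'] at hxy
    linear_combination -hxy)
  obtain ⟨x', hx'⟩ := hσ0.symm.dvd
  obtain ⟨y', hy'⟩ := hσ1.symm.dvd
  have hdet := BinForm.det_eq σ
  have hdetO : ((σ 0 0 : ℤ) : 𝓞 K) * (σ 1 1 : ℤ) - (σ 0 1 : ℤ) * (σ 1 0 : ℤ) = 1 := by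
    exact_mod_cast congrArg (Int.cast : ℤ → 𝓞 K) hdet
  obtain ⟨ξ, hξ⟩ : ∃ ξ : 𝓞 K, ξ = σ 0 0 * e₁ + σ 0 1 * e₂ := ⟨_, rfl⟩
  obtain ⟨ν, hν⟩ : ∃ ν : 𝓞 K, ν = σ 1 0 * e₁ + σ 1 1 * e₂ := ⟨_, rfl⟩
  have hξJ : ξ ∈ J := hξ ▸ J.add_mem (J.mul_mem_left _ he₁) (J.mul_mem_left _ he₂)
  have hνJ : ν ∈ J := hν ▸ J.add_mem (J.mul_mem_left _ he₁) (J.mul_mem_left _ he₂)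
  have hspan' : ∀ z ∈ J, ∃ s t : ℤ, z = s * ξ + t * ν := by
    intro z hz
    obtain ⟨s, t, rfl⟩ := hspan z hz
    refine ⟨s * σ 1 1 - t * σ 1 0, t * σ 0 0 - s * σ 0 1, ?_⟩
    rw [hξ, hν]
    push_cast
    linear_combination (-(s * e₁ + t * e₂) : 𝓞 K) * hdetO
  have him' : 0 < (ι (ξ : K) * (starRingEnd ℂ) (ι (ν : K))).im := by
    have hdetR : ((σ 0 0 : ℤ) : ℝ) * (σ 1 1 : ℤ) - (σ 0 1 : ℤ) * (σ 1 0 : ℤ) = 1 := by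
      exact_mod_cast congrArg (Int.cast : ℤ → ℝ) hdet
    have : (ι (ξ : K) * (starRingEnd ℂ) (ι (ν : K))).im =
        (ι (e₁ : K) * (starRingEnd ℂ) (ι (e₂ : K))).im := by
      rw [hξ, hν]
      simp
      linear_combination ((ι (e₁ : K)).im * (ι (e₂ : K)).re -
        (ι (e₁ : K)).re * (ι (e₂ : K)).im) * hdetR
    rwa [this]
  have hν0 : ν ≠ 0 := by rintro rfl; simp at him'
  -- Modulo N the second row of σ is (x, y), so ν ≡ xe₁ + ye₂ = n ≡ 1.
  obtain ⟨w, hw⟩ : ∃ w : 𝓞 K, ν = 1 + N * w := by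
    refine ⟨n' + x' * e₁ + y' * e₂, ?_⟩
    have h0 : ((σ 1 0 : ℤ) : 𝓞 K) = x + N * x' := by
      have : σ 1 0 = x + N * x' := by linarith
      exact_mod_cast congrArg (Int.cast : ℤ → 𝓞 K) this
    have h1 : ((σ 1 1 : ℤ) : 𝓞 K) = y + N * y' := by
      have : σ 1 1 = y + N * y' := by linarith
      exact_mod_cast congrArg (Int.cast : ℤ → 𝓞 K) this
    have h2 : (n : 𝓞 K) = 1 + N * n' := by rw [hn]; push_cast; rfl
    rw [hν, h0, h1]
    linear_combination h2 - hxy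
  obtain ⟨Q, ha, hd, hom, k, hk⟩ := G.exists_form_of_oriented_generators hξJ hνJ hspan' him'
  -- In (θ - k)ν = aξ with ν = 1 + Nw, a common divisor of a and N divides θ - k.
  have hgcd : Int.gcd N Q.a = 1 := by
    obtain ⟨q, hq⟩ := Int.gcd_dvd_left (N : ℤ) Q.a
    obtain ⟨a', ha'⟩ := Int.gcd_dvd_right (N : ℤ) Q.a
    set g := Int.gcd N Q.a
    have hq' : (N : 𝓞 K) = g * q := by exact_mod_cast congrArg (Int.cast : ℤ → 𝓞 K) hq
    have ha'' : (Q.a : 𝓞 K) = g * a' := by exact_mod_cast congrArg (Int.cast : ℤ → 𝓞 K) ha'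
    have h1 : (((g : ℤ)) : 𝓞 K) * (a' * ξ - (G.θ - k) * q * w) = G.θ - k := by
      rw [hw, ha'', hq'] at hk
      push_cast
      linear_combination -hk
    have := G.int_dvd_one_of_mul_eq_sub h1
    exact Nat.dvd_one.mp (by exact_mod_cast this)
  have hpos : Q.IsPosDef := BinForm.isPosDef_of_a_pos_of_disc_neg ha (hd ▸ G.discr_lt_zero)
  obtain ⟨Q', hQ'⟩ : ∃ Q' : FormsPrimeTo N (discr K), Q'.1 = Q :=
    ⟨⟨Q, G.isPrimitive ha hd, hpos, hd, hgcd⟩, rfl⟩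
  refine ⟨Q', Eq.symm ?_⟩
  have hmK : (m : K) ≠ 0 := by exact_mod_cast hm0
  have hνK : (ν : K) ≠ 0 := by simpa using hν0
  -- [ω_Q, 1] = ν⁻¹J = (m/ν)I, with m and ν both ≡ 1 mod N.
  refine (mk_eq_mk_iff _ _).mpr ⟨Units.mk0 ((m : K) / ν) (div_ne_zero hmK hνK), ?_, ?_⟩
  · have hco : ∀ z : 𝓞 K, IsCoprime (1 + N * z) (N : 𝓞 K) := fun z =>
      isCoprime_one_left.add_mul_left_left z
    have hmO : (m : 𝓞 K) = 1 + N * (m' : 𝓞 K) := by rw [hm]; push_cast; rfl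
    refine ⟨m, ν, by exact_mod_cast hm0, hν0, ?_, ?_, ?_, by simp⟩
    · rw [Ideal.isCoprime_span_singleton_iff, hmO]
      exact hco _
    · rw [Ideal.isCoprime_span_singleton_iff, hw]
      exact hco _
    · rw [Ideal.mem_span_singleton, hmO, hw]
      exact ⟨m' - w, by ring⟩
  · rw [coe_idealOfForm, hQ', latticeIdeal_eq_of_generators ha hd hξJ hνJ hν0 hspan' hom, hJI,
      ← mul_assoc, FractionalIdeal.spanSingleton_mul_spanSingleton, Units.val_mk0, div_eq_inv_mul]

end QuadGen

/-! ### Dirichlet composition and products of lattices. -/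

theorem mem_lattice {ω z : ℂ} : z ∈ lattice ω ↔ ∃ s t : ℤ, z = s * ω + t := by
  simp only [lattice, Submodule.mem_span_pair, zsmul_eq_mul, mul_one, eq_comm]

namespace BinForm

variable {Q₁ Q₂ : BinForm} {B : ℤ}

theorem IsCompositionCoeff.mul_c (h : Q₁.IsCompositionCoeff Q₂ B) :
    4 * Q₁.a * Q₂.a * (Q₁.dirichletComp Q₂ B).c = B ^ 2 - Q₁.disc :=
  Int.mul_ediv_cancel' h.2.2.symm.dvd

theorem IsCompositionCoeff.disc_dirichletComp (h : Q₁.IsCompositionCoeff Q₂ B) :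
    (Q₁.dirichletComp Q₂ B).disc = Q₁.disc := by
  have h1 := h.mul_c
  have h2 : (Q₁.dirichletComp Q₂ B).disc =
    B ^ 2 - 4 * (Q₁.a * Q₂.a) * (Q₁.dirichletComp Q₂ B).c := rfl
  linear_combination h2 - h1

/-- B may replace (b₁ + b₂)/2: adding the two congruences for B shows that they differ by a
combination of a₁ and a₂. -/
theorem Composable.exists_bezout_coeff (h : Q₁.Composable Q₂) (hd : Q₁.disc = Q₂.disc)
    (hB : Q₁.IsCompositionCoeff Q₂ B) : ∃ x y z : ℤ, x * Q₁.a + y * Q₂.a + z * B = 1 := by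
  obtain ⟨x, y, z, hb⟩ := h.exists_bezout
  obtain ⟨s, hs⟩ := two_dvd_b_add_b hd
  have hs' : (Q₁.b + Q₂.b) / 2 = s := by rw [hs]; simp
  rw [hs'] at hb
  obtain ⟨k, hk⟩ := hB.1.symm.dvd
  obtain ⟨l, hl⟩ := hB.2.1.symm.dvd
  have hBs : B = s + Q₁.a * k + Q₂.a * l := by linarith
  exact ⟨x - z * k, y - z * l, z, by rw [hBs]; linear_combination hb⟩

/-- The norm of `u ω_Q + v` is `Q(v, -u) / a`. -/
theorem mul_normSq_automorphy {Q : BinForm} (ha : 0 < Q.a) (hd : Q.disc < 0) (u v : ℤ) :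
    (Q.a : ℝ) * Complex.normSq (u * Q.omega + v) = Q.eval v (-u) := by
  obtain ⟨him, hq⟩ := (Q.omega_spec ha hd _).mpr rfl
  have hre' := congrArg Complex.re hq
  have him' := congrArg Complex.im hq
  rw [sq] at hre' him'
  simp at hre' him'
  have h1 : 2 * Q.a * Q.omega.re + Q.b = 0 := by
    have : Q.omega.im * (2 * Q.a * Q.omega.re + Q.b) = 0 := by linear_combination him'
    exact (mul_eq_zero.mp this).resolve_left him.ne'
  simp only [Complex.normSq_apply, eval]
  simp
  linear_combination (u * v + u ^ 2 * Q.omega.re : ℝ) * h1 - (u ^ 2 : ℝ) * hre'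

end BinForm

namespace QuadGen

variable {K : Type*} [Field K] [NumberField K] {ι : K →+* ℂ} {G : QuadGen K ι} {N : ℕ}
  {Q₁ Q₂ : BinForm} {B : ℤ}

theorem omega_eq_dirichletComp_left (ha₁ : 0 < Q₁.a) (ha₂ : 0 < Q₂.a)
    (hB : Q₁.IsCompositionCoeff Q₂ B) :
    ∃ k : ℤ, G.omega Q₁ = Q₂.a * G.omega (Q₁.dirichletComp Q₂ B) + k := by
  obtain ⟨k, hk⟩ := hB.1.symm.dvd
  have hk' : (B : K) - Q₁.b = 2 * Q₁.a * k := by exact_mod_cast congrArg (Int.cast : ℤ → K) hk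
  have h0 : (2 * Q₁.a : K) ≠ 0 := by exact_mod_cast (by simpa using ha₁.ne' : 2 * Q₁.a ≠ 0)
  have h1 := two_mul_omega (G := G) ha₁
  have h2 := two_mul_omega (G := G) (Q := Q₁.dirichletComp Q₂ B) (mul_pos ha₁ ha₂)
  refine ⟨k, mul_left_cancel₀ h0 ?_⟩
  simp only [BinForm.dirichletComp] at h2 ⊢
  push_cast at h2
  linear_combination h1 - h2 + hk'

theorem omega_eq_dirichletComp_right (ha₁ : 0 < Q₁.a) (ha₂ : 0 < Q₂.a)
    (hB : Q₁.IsCompositionCoeff Q₂ B) :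
    ∃ k : ℤ, G.omega Q₂ = Q₁.a * G.omega (Q₁.dirichletComp Q₂ B) + k := by
  obtain ⟨k, hk⟩ := hB.2.1.symm.dvd
  have hk' : (B : K) - Q₂.b = 2 * Q₂.a * k := by exact_mod_cast congrArg (Int.cast : ℤ → K) hk
  have h0 : (2 * Q₂.a : K) ≠ 0 := by exact_mod_cast (by simpa using ha₂.ne' : 2 * Q₂.a ≠ 0)
  have h1 := two_mul_omega (G := G) ha₂
  have h2 := two_mul_omega (G := G) (Q := Q₁.dirichletComp Q₂ B) (mul_pos ha₁ ha₂)
  refine ⟨k, mul_left_cancel₀ h0 ?_⟩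
  simp only [BinForm.dirichletComp] at h2 ⊢
  push_cast at h2
  linear_combination h1 - h2 + hk'

/-- With ω₁ = a₂ω₀ + k and ω₂ = a₁ω₀ + l, one has (ω₁ - k)(ω₂ - l) = a₁a₂ω₀² = -Bω₀ - c₀. So the
product contains a₁ω₀, a₂ω₀ and Bω₀, hence ω₀ by Bézout. -/
theorem latticeIdeal_mul (hp₁ : 0 < Q₁.a) (hd₁ : Q₁.disc = discr K) (hp₂ : 0 < Q₂.a)
    (hd₂ : Q₂.disc = discr K) (h : Q₁.Composable Q₂) (hB : Q₁.IsCompositionCoeff Q₂ B) :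
    G.latticeIdeal Q₁ * G.latticeIdeal Q₂ = G.latticeIdeal (Q₁.dirichletComp Q₂ B) := by
  obtain ⟨x, y, z, hxyz⟩ := h.exists_bezout_coeff (hd₁.trans hd₂.symm) hB
  have hxyz' : (x : K) * Q₁.a + y * Q₂.a + z * B = 1 := by
    exact_mod_cast congrArg (Int.cast : ℤ → K) hxyz
  obtain ⟨k, hk⟩ := omega_eq_dirichletComp_left (G := G) hp₁ hp₂ hB
  obtain ⟨l, hl⟩ := omega_eq_dirichletComp_right (G := G) hp₁ hp₂ hB
  have hp₀ : 0 < (Q₁.dirichletComp Q₂ B).a := mul_pos hp₁ hp₂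
  have hd₀ : (Q₁.dirichletComp Q₂ B).disc = discr K := hB.disc_dirichletComp.trans hd₁
  have hq := omega_quadratic (G := G) hp₀ hd₀
  have hq' : (Q₁.a * Q₂.a : K) * G.omega (Q₁.dirichletComp Q₂ B) ^ 2 +
      B * G.omega (Q₁.dirichletComp Q₂ B) + (Q₁.dirichletComp Q₂ B).c = 0 := by
    rw [← hq]
    simp only [BinForm.dirichletComp]
    push_cast
    ring
  apply le_antisymm
  · rw [FractionalIdeal.mul_le]
    intro i hi j hj
    obtain ⟨s, t, rfl⟩ := (mem_latticeIdeal hp₁ hd₁).mp hi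
    obtain ⟨s', t', rfl⟩ := (mem_latticeIdeal hp₂ hd₂).mp hj
    refine (mem_latticeIdeal hp₀ hd₀).mpr
      ⟨-(s * s' * B) + s * Q₂.a * (s' * l + t') + s' * Q₁.a * (s * k + t),
        (s * k + t) * (s' * l + t') - s * s' * (Q₁.dirichletComp Q₂ B).c, ?_⟩
    rw [hk, hl]
    push_cast
    linear_combination (s * s' : K) * hq'
  · set M := G.latticeIdeal Q₁ * G.latticeIdeal Q₂
    have h11 : (1 : K) ∈ M := by
      simpa using FractionalIdeal.mul_mem_mul (one_mem_latticeIdeal (G := G) (Q := Q₁))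
        (one_mem_latticeIdeal (G := G) (Q := Q₂))
    have h1w : G.omega Q₂ ∈ M := by
      simpa using FractionalIdeal.mul_mem_mul (one_mem_latticeIdeal (G := G) (Q := Q₁))
        (omega_mem_latticeIdeal (G := G) (Q := Q₂))
    have hw1 : G.omega Q₁ ∈ M := by
      simpa using FractionalIdeal.mul_mem_mul (omega_mem_latticeIdeal (G := G) (Q := Q₁))
        (one_mem_latticeIdeal (G := G) (Q := Q₂))
    have hww : G.omega Q₁ * G.omega Q₂ ∈ M :=
      FractionalIdeal.mul_mem_mul omega_mem_latticeIdeal omega_mem_latticeIdeal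
    have hadd : ∀ {a b : K}, a ∈ M → b ∈ M → a + b ∈ M :=
      fun ha hb => (M : Submodule (𝓞 K) K).add_mem ha hb
    have h0 : G.omega (Q₁.dirichletComp Q₂ B) ∈ M := by
      -- Expansion of x(ω₂ - l) + y(ω₁ - k) - z((ω₁ - k)(ω₂ - l) + c₀).
      have e : G.omega (Q₁.dirichletComp Q₂ B) =
          ((-z : ℤ) : K) * (G.omega Q₁ * G.omega Q₂) + ((y + z * l : ℤ) : K) * G.omega Q₁ +
          ((x + z * k : ℤ) : K) * G.omega Q₂ +
          ((-(x * l) - y * k - z * (k * l + (Q₁.dirichletComp Q₂ B).c) : ℤ) : K) * 1 := by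
        rw [hk, hl]
        push_cast
        linear_combination (-G.omega (Q₁.dirichletComp Q₂ B)) * hxyz' + (z : K) * hq'
      rw [e]
      exact hadd (hadd (hadd (FractionalIdeal.intCast_mul_mem _ _ hww)
        (FractionalIdeal.intCast_mul_mem _ _ hw1)) (FractionalIdeal.intCast_mul_mem _ _ h1w))
        (FractionalIdeal.intCast_mul_mem _ _ h11)
    intro i hi
    obtain ⟨s, t, rfl⟩ := (mem_latticeIdeal hp₀ hd₀).mp hi
    refine hadd (FractionalIdeal.intCast_mul_mem _ _ h0) ?_
    simpa using FractionalIdeal.intCast_mul_mem _ t h11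

theorem mem_lattice_iff {Q : BinForm} (ha : 0 < Q.a) (hd : Q.disc = discr K) {z : ℂ} :
    z ∈ lattice Q.omega ↔ ∃ x ∈ G.latticeIdeal Q, ι x = z := by
  rw [← SetLike.mem_coe, ← image_latticeIdeal (G := G) ha hd]
  rfl

theorem lattice_mul (G : QuadGen K ι) (hp₁ : 0 < Q₁.a) (hd₁ : Q₁.disc = discr K) (hp₂ : 0 < Q₂.a)
    (hd₂ : Q₂.disc = discr K) (h : Q₁.Composable Q₂) (hB : Q₁.IsCompositionCoeff Q₂ B) :
    lattice Q₁.omega * lattice Q₂.omega = lattice (Q₁.dirichletComp Q₂ B).omega := by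
  have hp₀ : 0 < (Q₁.dirichletComp Q₂ B).a := mul_pos hp₁ hp₂
  have hd₀ : (Q₁.dirichletComp Q₂ B).disc = discr K := hB.disc_dirichletComp.trans hd₁
  have hI := latticeIdeal_mul (G := G) hp₁ hd₁ hp₂ hd₂ h hB
  apply le_antisymm
  · rw [Submodule.mul_le]
    intro i hi j hj
    obtain ⟨x, hx, rfl⟩ := (mem_lattice_iff (G := G) hp₁ hd₁).mp hi
    obtain ⟨y, hy, rfl⟩ := (mem_lattice_iff (G := G) hp₂ hd₂).mp hj
    exact (mem_lattice_iff (G := G) hp₀ hd₀).mpr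
      ⟨x * y, hI ▸ FractionalIdeal.mul_mem_mul hx hy, map_mul ι x y⟩
  · intro z hz
    obtain ⟨x, hx, rfl⟩ := (mem_lattice_iff (G := G) hp₀ hd₀).mp hz
    rw [← hI] at hx
    refine FractionalIdeal.mul_induction_on hx (fun i hi j hj => ?_) (fun a b ha hb => ?_)
    · rw [map_mul]
      exact Submodule.mul_mem_mul ((mem_lattice_iff (G := G) hp₁ hd₁).mpr ⟨i, hi, rfl⟩)
        ((mem_lattice_iff (G := G) hp₂ hd₂).mpr ⟨j, hj, rfl⟩)
    · rw [map_add]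
      exact Submodule.add_mem _ ha hb

/-- Compare norms in `h`: the right side has norm Q₀(v, -u)/(a₁a₃), and the left side a₂/a₃, since
evaluating Q₂^ρ at that row undoes ρ and returns a₂. -/
theorem eval_dirichletComp (hQ₁ : Q₁.IsPosDef) (hd₁ : Q₁.disc < 0) (hQ₂ : Q₂.IsPosDef)
    (hd₂ : Q₂.disc < 0) (ρ : SL(2, ℤ)) (hB : Q₁.IsCompositionCoeff (Q₂.act ρ) B) {u v : ℤ}
    (h : (ρ 1 0 : ℂ) * (Q₂.act ρ).omega + (ρ 1 1 : ℂ) =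
      (u : ℂ) * (Q₁.dirichletComp (Q₂.act ρ) B).omega + (v : ℂ)) :
    (Q₁.dirichletComp (Q₂.act ρ) B).eval v (-u) = Q₁.a * Q₂.a := by
  have ha₃ := act_a_pos hQ₂ ρ
  have h0 := BinForm.mul_normSq_automorphy (Q := Q₁.dirichletComp (Q₂.act ρ) B)
    (mul_pos hQ₁.a_pos ha₃) (hB.disc_dirichletComp ▸ hd₁) u v
  have h3 := BinForm.mul_normSq_automorphy (Q := Q₂.act ρ) ha₃ (Q₂.disc_act ρ ▸ hd₂)
    (ρ 1 0) (ρ 1 1)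
  rw [← BinForm.act_inv_a, ← BinForm.act_mul, mul_inv_cancel, BinForm.act_one, h] at h3
  have : ((Q₁.dirichletComp (Q₂.act ρ) B).eval v (-u) : ℝ) = Q₁.a * Q₂.a := by
    rw [← h0, ← h3]
    simp only [BinForm.dirichletComp]
    push_cast
    ring
  exact_mod_cast this

theorem isCoprime_a_mul_a (Q₁ Q₂ : FormsPrimeTo N (discr K)) :
    IsCoprime (Q₁.1.a * Q₂.1.a) (N : ℤ) :=
  (Int.isCoprime_iff_gcd_eq_one.mpr Q₁.2.2.2.2).symm.mul_left
    (Int.isCoprime_iff_gcd_eq_one.mpr Q₂.2.2.2.2).symm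

theorem mul_mem_latticeIdeal_mul (hp₁ : 0 < Q₁.a) (hd₁ : Q₁.disc = discr K) (hp₂ : 0 < Q₂.a)
    (hd₂ : Q₂.disc = discr K) {x : K} (hx : x ∈ G.latticeIdeal Q₁ * G.latticeIdeal Q₂) :
    ∃ z : 𝓞 K, (z : K) = Q₁.a * Q₂.a * x := by
  refine FractionalIdeal.mul_induction_on hx (fun i hi j hj => ?_) ?_
  · obtain ⟨z, hz⟩ := mul_mem_latticeIdeal hp₁ hd₁ hi
    obtain ⟨z', hz'⟩ := mul_mem_latticeIdeal hp₂ hd₂ hj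
    exact ⟨z * z', by
      simp only [map_mul]
      linear_combination (z' : K) * hz + (Q₁.a * i : K) * hz'⟩
  · rintro a b ⟨z, hz⟩ ⟨z', hz'⟩
    exact ⟨z + z', by
      simp only [map_add]
      linear_combination hz' + hz⟩

/-- The form `Q₀` below is the composition of `Q₁` with `Q₂^ρ`. -/
theorem rayClass_mul_eq (Q₁ Q₂ Q₄ : FormsPrimeTo N (discr K)) {Q₀ : BinForm} {ρ σ : SL(2, ℤ)}
    (h₀ : 0 < Q₀.a) (h₄ : Q₄.1.act σ = Q₀)
    (hI : G.latticeIdeal Q₁.1 * G.latticeIdeal (Q₂.1.act ρ) = G.latticeIdeal Q₀) {u v : ℤ}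
    (huv : (ρ 1 0 : K) * G.omega (Q₂.1.act ρ) + ρ 1 1 = u * G.omega Q₀ + v)
    (hu : σ 1 0 ≡ u [ZMOD N]) (hv : σ 1 1 ≡ v [ZMOD N]) :
    G.rayClass Q₁ * G.rayClass Q₂ = G.rayClass Q₄ := by
  have hd₀ : Q₀.disc = discr K := by rw [← h₄, BinForm.disc_act, Q₄.2.2.2.1]
  have hρ := latticeIdeal_act (G := G) Q₂.2.2.1 Q₂.2.2.2.1 ρ
  have hσ := latticeIdeal_act (G := G) Q₄.2.2.1 Q₄.2.2.2.1 σ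
  rw [h₄] at hσ
  have hjρ : (ρ 1 0 : K) * G.omega (Q₂.1.act ρ) + ρ 1 1 ≠ 0 :=
    automorphy_ne_zero (act_a_pos Q₂.2.2.1 ρ) (row_ne_zero ρ)
  have hjσ : (σ 1 0 : K) * G.omega Q₀ + σ 1 1 ≠ 0 := automorphy_ne_zero h₀ (row_ne_zero σ)
  obtain ⟨s, hs⟩ := hu.symm.dvd
  obtain ⟨t, ht⟩ := hv.symm.dvd
  have hs' : (σ 1 0 : K) - u = N * s := by exact_mod_cast congrArg (Int.cast : ℤ → K) hs
  have ht' : (σ 1 1 : K) - v = N * t := by exact_mod_cast congrArg (Int.cast : ℤ → K) ht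
  generalize (ρ 1 0 : K) * G.omega (Q₂.1.act ρ) + ρ 1 1 = jρ at *
  have hjj : (σ 1 0 : K) * G.omega Q₀ + σ 1 1 = jρ + N * (s * G.omega Q₀ + t) := by
    linear_combination G.omega Q₀ * hs' + ht' - huv
  generalize (σ 1 0 : K) * G.omega Q₀ + σ 1 1 = jσ at *
  have hI' : G.latticeIdeal Q₀ = FractionalIdeal.spanSingleton (𝓞 K)⁰ jρ *
      (G.latticeIdeal Q₁.1 * G.latticeIdeal Q₂.1) := by
    rw [← hI, hρ]
    ring
  -- jσ/jρ = 1 + Ny with y in the product of the lattices of Q₁ and Q₂, so a₁a₂y is integral while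
  -- a₁a₂ is prime to N.
  have hunit : (Units.mk0 (jσ / jρ) (div_ne_zero hjσ hjρ))⁻¹ ∈
      congrOne K (Ideal.span {(N : 𝓞 K)}) := by
    refine inv_mem ?_
    have hm : (s : K) * G.omega Q₀ + t ∈ G.latticeIdeal Q₀ :=
      (mem_latticeIdeal h₀ hd₀).mpr ⟨s, t, rfl⟩
    rw [hI'] at hm
    obtain ⟨y, hy, hy'⟩ := FractionalIdeal.mem_singleton_mul.mp hm
    obtain ⟨z, hz⟩ := mul_mem_latticeIdeal_mul Q₁.2.2.1.a_pos Q₁.2.2.2.1 Q₂.2.2.1.a_pos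
      Q₂.2.2.2.1 hy
    refine mem_congrOne_of_mul_eq (m := Q₁.1.a * Q₂.1.a)
      (mul_pos Q₁.2.2.1.a_pos Q₂.2.2.1.a_pos).ne' (isCoprime_a_mul_a Q₁ Q₂) z ?_
    rw [hz, Units.val_mk0, hjj, hy']
    field_simp
    push_cast
    ring
  refine (mk_eq_mk_iff (G.idealOfForm Q₁ * G.idealOfForm Q₂) (G.idealOfForm Q₄)).mpr
    ⟨_, hunit, ?_⟩
  rw [Subgroup.coe_mul, Units.val_mul, coe_idealOfForm, coe_idealOfForm, coe_idealOfForm,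
    Units.val_inv_eq_inv_val, Units.val_mk0, inv_div]
  have h1 : G.latticeIdeal Q₄.1 = FractionalIdeal.spanSingleton (𝓞 K)⁰ jσ⁻¹ *
      G.latticeIdeal Q₀ := by
    rw [hσ, ← mul_assoc, FractionalIdeal.spanSingleton_mul_spanSingleton, inv_mul_cancel₀ hjσ,
      FractionalIdeal.spanSingleton_one, one_mul]
  rw [h1, hI', ← mul_assoc, FractionalIdeal.spanSingleton_mul_spanSingleton, div_eq_inv_mul]

/-! ### The bijection and the main theorem. -/

variable (G N) in
/-- The map `[Q] ↦ ` ray class of `[ω_Q, 1]`. -/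
noncomputable def classMap : FormClass N (discr K) → RayClassGroup K (Ideal.span {(N : 𝓞 K)}) :=
  Quotient.lift G.rayClass fun _ _ ⟨_, hσ, h⟩ => rayClass_eq_of_equiv hσ h

theorem classMap_bijective [Algebra.IsQuadraticExtension ℚ K] (G : QuadGen K ι) (hN : 0 < N) :
    Function.Bijective (G.classMap N) := by
  constructor
  · rintro ⟨Q⟩ ⟨Q'⟩ h
    exact Quotient.sound (exists_act_eq_of_rayClass_eq h)
  · intro c
    obtain ⟨Q, rfl⟩ := G.rayClass_surjective hN c
    exact ⟨FormClass.mk Q, rfl⟩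

end QuadGen

theorem theorem2p8 (K : Type*) [Field K] [NumberField K] [Algebra.IsQuadraticExtension ℚ K]
    [NumberField.IsTotallyComplex K] (ι : K →+* ℂ)
    (hK₁ : ∀ x : K, x ^ 2 ≠ -1) (hK₃ : ∀ x : K, x ^ 2 ≠ -3)
    (N : ℕ) (hN : 0 < N) :
    ∃ (_ : CommGroup (FormClass N (discr K)))
      (φ : FormClass N (discr K) ≃* RayClassGroup K (Ideal.span {(N : 𝓞 K)})),
      -- `φ [Q]` is the ray class of the fractional ideal `[ω_Q, 1]`, which is prime to `N𝓞_K`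
      (∀ Q : FormsPrimeTo N (discr K),
        ∃ 𝔞 : idealsPrimeTo K (Ideal.span {(N : 𝓞 K)}),
          ι '' {x : K | x ∈ ((𝔞 : (FractionalIdeal (𝓞 K)⁰ K)ˣ) : FractionalIdeal (𝓞 K)⁰ K)} = (lattice Q.1.omega : Set ℂ) ∧
          φ (FormClass.mk Q) = QuotientGroup.mk 𝔞) ∧
      -- the product of two classes through Dirichlet composition
      (∀ Q₁ Q₂ : FormsPrimeTo N (discr K),
        (∃ ρ : SL(2, ℤ), Q₁.1.Composable (Q₂.1.act ρ)) ∧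
        ∀ ρ : SL(2, ℤ), Q₁.1.Composable (Q₂.1.act ρ) →
          (∃ B : ℤ, Q₁.1.IsCompositionCoeff (Q₂.1.act ρ) B) ∧
          ∀ B : ℤ, Q₁.1.IsCompositionCoeff (Q₂.1.act ρ) B →
            lattice Q₁.1.omega * lattice (Q₂.1.act ρ).omega =
              lattice (Q₁.1.dirichletComp (Q₂.1.act ρ) B).omega ∧
            (∃ u v : ℤ, (ρ 1 0 : ℂ) * (Q₂.1.act ρ).omega + (ρ 1 1 : ℂ) =
              (u : ℂ) * (Q₁.1.dirichletComp (Q₂.1.act ρ) B).omega + (v : ℂ)) ∧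
            ∀ u v : ℤ, (ρ 1 0 : ℂ) * (Q₂.1.act ρ).omega + (ρ 1 1 : ℂ) =
                (u : ℂ) * (Q₁.1.dirichletComp (Q₂.1.act ρ) B).omega + (v : ℂ) →
              (∃ σ : SL(2, ℤ), σ 1 0 ≡ u [ZMOD N] ∧ σ 1 1 ≡ v [ZMOD N]) ∧
              ∀ σ : SL(2, ℤ), σ 1 0 ≡ u [ZMOD N] → σ 1 1 ≡ v [ZMOD N] →
                ∃ Q₄ : FormsPrimeTo N (discr K),
                  Q₄.1.act σ = Q₁.1.dirichletComp (Q₂.1.act ρ) B ∧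
                  FormClass.mk Q₁ * FormClass.mk Q₂ = FormClass.mk Q₄) := by
  obtain ⟨G⟩ := nonempty_quadGen ι
  let e := Equiv.ofBijective (G.classMap N) (G.classMap_bijective hN)
  let := e.commGroup
  refine ⟨e.commGroup, e.mulEquiv, fun Q => ⟨G.idealOfForm Q, ?_, rfl⟩, fun Q₁ Q₂ => ?_⟩
  · exact QuadGen.image_latticeIdeal Q.2.2.1.a_pos Q.2.2.2.1
  have hd := G.discr_lt_zero
  obtain ⟨-, pos₁, disc₁, -⟩ := Q₁.2
  obtain ⟨prim₂, pos₂, disc₂, -⟩ := Q₂.2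
  refine ⟨BinForm.exists_composable _ pos₁.a_pos.ne' prim₂, fun ρ hρ => ?_⟩
  have pos₃ := QuadGen.act_a_pos pos₂ ρ
  have disc₃ := (Q₂.1.disc_act ρ).trans disc₂
  refine ⟨hρ.exists_isCompositionCoeff (disc₁.trans disc₃.symm), fun B hB => ?_⟩
  have hlat := G.lattice_mul pos₁.a_pos disc₁ pos₃ disc₃ hρ hB
  have pos₀ : 0 < (Q₁.1.dirichletComp (Q₂.1.act ρ) B).a := mul_pos pos₁.a_pos pos₃
  have disc₀ : (Q₁.1.dirichletComp (Q₂.1.act ρ) B).disc = discr K :=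
    hB.disc_dirichletComp.trans disc₁
  refine ⟨hlat, ?_, fun u v huv => ?_⟩
  -- j(ρ, ω_{Q₃}) = 1 · j(ρ, ω_{Q₃}) lies in the product of the two lattices.
  · rw [← mem_lattice, ← hlat]
    have h1 : (1 : ℂ) ∈ lattice Q₁.1.omega := mem_lattice.mpr ⟨0, 1, by simp⟩
    simpa using Submodule.mul_mem_mul h1
      (mem_lattice.mpr ⟨ρ 1 0, ρ 1 1, rfl⟩ : _ ∈ lattice (Q₂.1.act ρ).omega)
  have heval := QuadGen.eval_dirichletComp pos₁ (disc₁.trans_lt hd) pos₂ (disc₂.trans_lt hd) ρ hB huv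
  have hcop := QuadGen.isCoprime_a_mul_a Q₁ Q₂
  refine ⟨exists_SL2_row_modEq (by exact_mod_cast hN.ne') fun p hp hu hv hpN => ?_,
    fun σ hu hv => ?_⟩
  -- A prime dividing u and v divides Q₀(v, -u) = a₁a₂, which is prime to N.
  · have h1 : (p : ℤ) ∣ Q₁.1.a * Q₂.1.a := by
      rw [← heval, BinForm.eval]
      exact dvd_add (dvd_add ((dvd_pow hv two_ne_zero).mul_left _) ((dvd_neg.mpr hu).mul_left _))
        ((dvd_pow (dvd_neg.mpr hu) two_ne_zero).mul_left _)
    exact (Nat.prime_iff_prime_int.mp hp).not_isUnit (hcop.isUnit_of_dvd' h1 hpN)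
  · have hact : ((Q₁.1.dirichletComp (Q₂.1.act ρ) B).act σ⁻¹).act σ =
        Q₁.1.dirichletComp (Q₂.1.act ρ) B := by
      rw [← BinForm.act_mul, inv_mul_cancel, BinForm.act_one]
    have def₀ := BinForm.isPosDef_of_a_pos_of_disc_neg pos₀ (disc₀.trans_lt hd)
    have pos₄ := QuadGen.act_a_pos def₀ σ⁻¹
    have disc₄ := (BinForm.disc_act _ σ⁻¹).trans disc₀
    have hgcd : Int.gcd N ((Q₁.1.dirichletComp (Q₂.1.act ρ) B).act σ⁻¹).a = 1 := by
      rw [← Int.isCoprime_iff_gcd_eq_one, BinForm.act_inv_a]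
      -- The leading coefficient of Q₄ is Q₀ at the inverse's first column, congruent to Q₀(v, -u) =
      -- a₁a₂ modulo N.
      have hmod : (Q₁.1.dirichletComp (Q₂.1.act ρ) B).eval (σ 1 1) (-σ 1 0) ≡
          Q₁.1.a * Q₂.1.a [ZMOD N] := by
        rw [← heval]
        unfold BinForm.eval
        gcongr
      obtain ⟨c, hc⟩ := hmod.symm.dvd
      rw [eq_add_of_sub_eq' hc]
      exact (hcop.add_mul_left_left c).symm
    obtain ⟨Q₄, hQ₄⟩ : ∃ Q₄ : FormsPrimeTo N (discr K),
        Q₄.1 = (Q₁.1.dirichletComp (Q₂.1.act ρ) B).act σ⁻¹ :=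
      ⟨⟨_, G.isPrimitive pos₄ disc₄, def₀.act _, disc₄, hgcd⟩, rfl⟩
    have h₄ : Q₄.1.act σ = Q₁.1.dirichletComp (Q₂.1.act ρ) B := by rw [hQ₄, hact]
    refine ⟨Q₄, h₄, e.mulEquiv.injective ?_⟩
    rw [map_mul]
    refine QuadGen.rayClass_mul_eq Q₁ Q₂ Q₄ pos₀ h₄
      (QuadGen.latticeIdeal_mul pos₁.a_pos disc₁ pos₃ disc₃ hρ hB) (ι.injective ?_) hu hv
    simpa [QuadGen.map_omega pos₃ disc₃, QuadGen.map_omega pos₀ disc₀] using huv
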